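/- Let $R=\bar R\setminus P$, where $\bar R$ is a compact connected Riemann surface and $P\subset\bar R$ is a finite, possibly empty, set of punctures, and suppose that $R$ is uniformized by the hyperbolic plane, with hyperbolic metric $\Lambda$ of curvature $-1$. A harmonic Beltrami differential on $R$ is a section $\mu=\Lambda^{-1}\otimes\bar q$, where $q$ is a holomorphic quadratic differential on $R$ with at most simple poles at the punctures. Write $\|\mu\|_0=\sup_R|\mu|$. For $r\in\mathbb Z$ and a local coordinate $z$ in which $\Lambda=(\lambda(z)|dz|)^2$, put $K_r=\lambda^{r-1}\frac{\partial}{\partial z}\lambda^{-r}$ and $L_r=\lambda^{-r-1}\frac{\partial}{\partial\bar z}\lambda^{r}$; $K_r$ raises the weight $r$ by one and $L_r$ lowers it by one, and Beltrami differentials have weight $-2$. A uniformizing disc is a holomorphic map $\{|z|<1\}\to R$ that pulls $\Lambda$ back to $\big(\frac{2|dz|}{1-|z|^2}\big)^2$. A uniformizing punctured disc is a holomorphic map $\{0<|z|<1\}\to R$ that pulls $\Lambda$ back to $\big(\frac{|dz|}{|z|\,|\log|z||}\big)^2$ and extends to a holomorphic map $\{|z|<1\}\to\bar R$ that is a local coordinate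 at a puncture, the image of $0$. (These maps need not be injective.) Choose an atlas of uniformizing discs and punctured discs, with a punctured disc at each puncture, such that the images of the parts $\{|z|<1/2\}$ of the discs and $\{0<|z|<1/2\}$ of the punctured discs cover $R$. For an integer $k\ge 0$ and $0<\alpha<1$, let $\|\mu\|_{k,\alpha}$ be the supremum over the charts of the atlas of $$\sum_{j=0}^k\ \sup_{|w|=j}\ \sup_{z}|D_w\mu(z)|\;+\;\sup_{|w|=k}\ \sup_{0<d(z_1,z_2)\le 1}\frac{|D_w\mu(z_1)-D_w\mu(z_2)|}{d(z_1,z_2)^\alpha},$$ where $D_w$ runs over the compositions of $|w|$ operators $K_*$, $L_*$ (starting at weight $-2$), applied to the expression of $\mu$ in the chart, the points $z,z_1,z_2$ lie in the part $|z|<1/2$ of the chart, and $d$ is the hyperbolic distance of the disc or punctured disc. Then for every integer $k\ge 0$ and every $0<\alpha<1$ there is a constant $C_{k,\alpha}>0$, depending only on $k$ and $\alpha$ (and not on the surface or the atlas), such that every harmonic Beltrami differential $\mu$ on every such surface $R$ satisfies $$\|\mu\|_0<\infty\qquad\text{and}\qquad\|\mu\|_0\le\|\mu\|_{k,\alpha}\le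 C_{k,\alpha}\,\|\mu\|_0 .$$ -/

import Mathlib

open Set Metric MeasureTheory
open scoped Manifold ContDiff NNReal ENNReal Topology ComplexConjugate

universe u

noncomputable section

namespace HarmonicBeltrami

section Sections

variable (X : Type u) [TopologicalSpace X] [ChartedSpace ℂ X]

/-- A section of `κ ^ m ⊗ conj κ ^ n`, with `κ` the canonical bundle of the Riemann surface `X`,
regarded as a function of tangent vectors that is homogeneous of bidegree `(m, n)`. Its coefficient
in a local coordinate `z` is its value on the coordinate vector `∂/∂z`. In terms of square roots of
`κ` this is a section of type `S(2m, 2n)`: quadratic differentials are `(m, n) = (2, 0)`, conformal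
metrics `(1, 1)`, Beltrami differentials `(-1, 1)`. Since `0 ^ i = 0` for an integer `i ≠ 0`, the
value on the zero vector is `0` unless `m = n = 0`. -/
structure Differential (m n : ℤ) where
  toFun : ∀ x : X, TangentSpace 𝓘(ℂ, ℂ) x → ℂ
  homogeneous : ∀ (x : X) (c : ℂ) (v : TangentSpace 𝓘(ℂ, ℂ) x),
    toFun x (c • v) = c ^ m * conj c ^ n * toFun x v

end Sections

section Surface

variable {X : Type u} [TopologicalSpace X] [ChartedSpace ℂ X]

/-- The coefficient at `z` of the pullback of `σ` by `f`: the value of `σ` on `f_* (∂/∂z)`. -/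
def Differential.pullback {m n : ℤ} (σ : Differential X m n) (f : ℂ → X) (z : ℂ) : ℂ :=
  σ.toFun (f z) (mfderiv 𝓘(ℂ, ℂ) 𝓘(ℂ, ℂ) f z (1 : ℂ))

/-- The unit disc. -/
def disc : Set ℂ := ball 0 1

/-- The punctured unit disc. -/
def puncturedDisc : Set ℂ := ball 0 1 \ {0}

/-- The density `λ` of the hyperbolic metric `(λ |dz|) ^ 2` (curvature `-1`) of the unit disc. -/
def discDensity (z : ℂ) : ℝ := 2 / (1 - ‖z‖ ^ 2)

/-- The density `λ` of the hyperbolic metric `(λ |dz|) ^ 2` (curvature `-1`) of the punctured unit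
disc. -/
def cuspDensity (z : ℂ) : ℝ := (‖z‖ * |Real.log ‖z‖|)⁻¹

/-- A uniformizing disc of the surface `X \ P` with metric `Λ`: a holomorphic map of the unit disc
to the surface that pulls `Λ` back to the hyperbolic metric of the disc. It need not be injective. -/
structure IsDiscChart (P : Set X) (Λ : Differential X 1 1) (f : ℂ → X) : Prop where
  mapsTo : MapsTo f disc Pᶜ
  holomorphic : MDifferentiableOn 𝓘(ℂ, ℂ) 𝓘(ℂ, ℂ) f disc
  isometric : ∀ z ∈ disc, Λ.pullback f z = ((discDensity z ^ 2 : ℝ) : ℂ)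

/-- A uniformizing punctured disc of the surface `X \ P` with metric `Λ`: a holomorphic map of the
punctured unit disc to the surface that pulls `Λ` back to the hyperbolic metric of the punctured
disc, and that extends to a local holomorphic coordinate of `X` at a puncture, the image of `0`. -/
structure IsCuspChart (P : Set X) (Λ : Differential X 1 1) (c : ℂ → X) : Prop where
  mapsTo : MapsTo c puncturedDisc Pᶜ
  zero_mem : c 0 ∈ P
  holomorphic : MDifferentiableOn 𝓘(ℂ, ℂ) 𝓘(ℂ, ℂ) c disc
  immersive : mfderiv 𝓘(ℂ, ℂ) 𝓘(ℂ, ℂ) c 0 ≠ 0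
  isometric : ∀ z ∈ puncturedDisc, Λ.pullback c z = ((cuspDensity z ^ 2 : ℝ) : ℂ)

/-- `X \ P` is uniformized by the hyperbolic plane and `Λ` is its hyperbolic metric: there is a
holomorphic covering of `X \ P` by the unit disc that pulls `Λ` back to the hyperbolic metric of the
disc. -/
def IsHyperbolicMetric (P : Set X) (Λ : Differential X 1 1) : Prop :=
  ∃ (π : ℂ → X) (hπ : IsDiscChart P Λ π),
    SurjOn π disc Pᶜ ∧ IsCoveringMap (hπ.mapsTo.restrict π disc Pᶜ)

/-- An atlas of uniformizing discs and punctured discs of the surface `X \ P`, with a punctured disc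
designated at each puncture, such that the discs and punctured discs of radius `1 / 2` cover. -/
structure UniformizingAtlas (P : Set X) (Λ : Differential X 1 1) where
  discs : Set (ℂ → X)
  cusps : Set (ℂ → X)
  isDiscChart : ∀ f ∈ discs, IsDiscChart P Λ f
  isCuspChart : ∀ c ∈ cusps, IsCuspChart P Λ c
  exists_cusp : ∀ p ∈ P, ∃ c ∈ cusps, c 0 = p
  covers : ∀ x ∈ Pᶜ, (∃ f ∈ discs, x ∈ f '' (disc ∩ ball 0 (1 / 2))) ∨
    ∃ c ∈ cusps, x ∈ c '' (puncturedDisc ∩ ball 0 (1 / 2))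

/-- `q` is a holomorphic quadratic differential on `X \ P` with at most simple poles at the points
of `P`. The values of `q` over `P` are irrelevant. -/
structure IsHolomorphicQuadratic (P : Set X) (q : Differential X 2 0) : Prop where
  holomorphic : ∀ e ∈ IsManifold.maximalAtlas 𝓘(ℂ, ℂ) ω X,
    DifferentiableOn ℂ (q.pullback e.symm) (e.target ∩ e.symm ⁻¹' Pᶜ)
  simple_pole : ∀ e ∈ IsManifold.maximalAtlas 𝓘(ℂ, ℂ) ω X, ∀ p ∈ P, p ∈ e.source →
    MeromorphicAt (q.pullback e.symm) (e p) ∧ -1 ≤ meromorphicOrderAt (q.pullback e.symm) (e p)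

/-- `μ` is a harmonic Beltrami differential: `μ = Λ⁻¹ ⊗ conj q` on `X \ P` for a holomorphic
quadratic differential `q` with at most simple poles at the punctures. -/
def IsHarmonic (P : Set X) (Λ : Differential X 1 1) (μ : Differential X (-1) 1) : Prop :=
  ∃ q : Differential X 2 0, IsHolomorphicQuadratic P q ∧
    ∀ x ∈ Pᶜ, ∀ v : TangentSpace 𝓘(ℂ, ℂ) x, μ.toFun x v = conj (q.toFun x v) / Λ.toFun x v

end Surface

section Operators

/-- `∂f/∂z`. -/
def dz (f : ℂ → ℂ) (z : ℂ) : ℂ := (fderiv ℝ f z 1 - Complex.I * fderiv ℝ f z Complex.I) / 2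

/-- `∂f/∂(conj z)`. -/
def dzbar (f : ℂ → ℂ) (z : ℂ) : ℂ := (fderiv ℝ f z 1 + Complex.I * fderiv ℝ f z Complex.I) / 2

/-- `K_r = λ ^ (r - 1) (∂/∂z) λ ^ (-r)`, from `S(r)` to `S(r + 1)`, for the metric `(λ |dz|) ^ 2`. -/
def opK (lam : ℂ → ℝ) (r : ℤ) (f : ℂ → ℂ) (z : ℂ) : ℂ :=
  (lam z : ℂ) ^ (r - 1) * dz (fun w => (lam w : ℂ) ^ (-r) * f w) z

/-- `L_r = λ ^ (-r - 1) (∂/∂(conj z)) λ ^ r`, from `S(r)` to `S(r - 1)`, for the metric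
`(λ |dz|) ^ 2`. -/
def opL (lam : ℂ → ℝ) (r : ℤ) (f : ℂ → ℂ) (z : ℂ) : ℂ :=
  (lam z : ℂ) ^ (-r - 1) * dzbar (fun w => (lam w : ℂ) ^ r * f w) z

/-- The two kinds of metric derivative. -/
inductive MetricDerivative
  | K
  | L

/-- The composition of metric derivatives prescribed by a word, first letter first, on the local
expression `f` of a section of `S(r)`. -/
def iteratedOp (lam : ℂ → ℝ) : List MetricDerivative → ℤ → (ℂ → ℂ) → ℂ → ℂ
  | [], _, f => f
  | .K :: w, r, f => iteratedOp lam w (r + 1) (opK lam r f)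
  | .L :: w, r, f => iteratedOp lam w (r - 1) (opL lam r f)

/-- The distance of the metric `(λ |dz|) ^ 2` on `U`: the infimum of the lengths of the `C¹` paths
in `U`. -/
def pathDist (U : Set ℂ) (lam : ℂ → ℝ) (z w : ℂ) : ℝ≥0∞ :=
  ⨅ (γ : ℝ → ℂ) (_ : ContDiff ℝ 1 γ) (_ : MapsTo γ (Icc 0 1) U) (_ : γ 0 = z) (_ : γ 1 = w),
    ∫⁻ t in Icc (0 : ℝ) 1, ENNReal.ofReal (lam (γ t) * ‖deriv γ t‖)

/-- The supremum over `V` of the metric derivatives of order `j` of `f`, the local expression of a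
section of `S(r)`. -/
def derivSup (V : Set ℂ) (lam : ℂ → ℝ) (r : ℤ) (j : ℕ) (f : ℂ → ℂ) : ℝ≥0∞ :=
  ⨆ (w : List MetricDerivative) (_ : w.length = j) (z ∈ V), ‖iteratedOp lam w r f z‖ₑ

/-- The supremum of the Hölder `α`-quotients of the metric derivatives of order `k` of `f`, over the
pairs of points of `V` at distance at most one in `U`. -/
def holderSup (U V : Set ℂ) (lam : ℂ → ℝ) (r : ℤ) (k : ℕ) (α : ℝ) (f : ℂ → ℂ) : ℝ≥0∞ :=
  ⨆ (w : List MetricDerivative) (_ : w.length = k) (z₁ ∈ V) (z₂ ∈ V)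
    (_ : pathDist U lam z₁ z₂ ≤ 1),
    ‖iteratedOp lam w r f z₁ - iteratedOp lam w r f z₂‖ₑ / pathDist U lam z₁ z₂ ^ α

open Classical in
/-- The `C^{k,α}` norm, on the part `|z| < 1 / 2` of `U`, of the local expression `f` of a section
of `S(r)`; it is infinite if `f` is not `C^k` there. -/
def chartNorm (U : Set ℂ) (lam : ℂ → ℝ) (r : ℤ) (k : ℕ) (α : ℝ) (f : ℂ → ℂ) : ℝ≥0∞ :=
  if ContDiffOn ℝ k f (U ∩ ball 0 (1 / 2)) then
    ∑ j ∈ Finset.range (k + 1), derivSup (U ∩ ball 0 (1 / 2)) lam r j f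
      + holderSup U (U ∩ ball 0 (1 / 2)) lam r k α f
  else ⊤

end Operators

section Norms

variable {X : Type u} [TopologicalSpace X] [ChartedSpace ℂ X]

/-- The supremum norm over `X \ P` of a Beltrami differential; the absolute value of a Beltrami
differential is the same on all nonzero tangent vectors at a point. -/
def supNorm (P : Set X) (μ : Differential X (-1) 1) : ℝ≥0∞ :=
  ⨆ (x ∈ Pᶜ) (v : TangentSpace 𝓘(ℂ, ℂ) x), ‖μ.toFun x v‖ₑ

/-- The `C^{k,α}` norm of a Beltrami differential, a section of `S(-2)`, relative to an atlas of
uniformizing discs and punctured discs. -/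
def holderNorm {P : Set X} {Λ : Differential X 1 1} (A : UniformizingAtlas P Λ) (k : ℕ) (α : ℝ)
    (μ : Differential X (-1) 1) : ℝ≥0∞ :=
  (⨆ f ∈ A.discs, chartNorm disc discDensity (-2) k α (μ.pullback f)) ⊔
    ⨆ c ∈ A.cusps, chartNorm puncturedDisc cuspDensity (-2) k α (μ.pullback c)

end Norms

end HarmonicBeltrami

end

/-!
In a uniformizing disc `μ` is `λ⁻² conj h` with `h` holomorphic. In a uniformizing punctured disc
`q` has at most a simple pole, so `h = z q` is holomorphic and `μ` is `z log² |z| conj h`.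
Metric derivatives turn such an expression into a sum `∑ gᵢ conj (h⁽ⁱ⁾)`, where the coefficients
`gᵢ` depend only on the model and are bounded on discs of radius less than one: they are smooth on
the disc, and combinations of `uⁿ |z|ᵈ logᵐ |z|` with `d ≥ 1` and `u = z / |z|` on the punctured
disc. On a circle `|z| = σ` the factor in front of `conj h` is bounded away from zero, so `h` is
controlled there by `‖μ‖₀`, and the Cauchy estimates control all of its derivatives on smaller
discs.

The Hölder quotients follow by integrating one more derivative along a nearly shortest path. Such a
path stays in a fixed smaller disc because the metric has a height function, `-log (1 - |z|²)` or
`-log (-log |z|)`, whose gradient it bounds and which is proper at `|z| = 1`.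
-/

noncomputable section

namespace HarmonicBeltrami

/-! ### Wirtinger derivatives -/

/-- The weight that a metric derivative adds: `K_r` raises the weight by one and `L_r` lowers it
by one. It is also the sign that distinguishes `∂/∂z` from `∂/∂(conj z)`. -/
def MetricDerivative.sign : MetricDerivative → ℤ
  | .K => 1
  | .L => -1

/-- The Wirtinger derivative underlying a metric derivative: `∂/∂z` for `K` and `∂/∂(conj z)`
for `L`. -/
def wirtinger : MetricDerivative → (ℂ → ℂ) → ℂ → ℂ
  | .K => dz
  | .L => dzbar

section Wirtinger

variable {a : MetricDerivative} {f g h φ : ℂ → ℂ} {z : ℂ}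

theorem wirtinger_eq (a : MetricDerivative) (f : ℂ → ℂ) (z : ℂ) :
    wirtinger a f z = (fderiv ℝ f z 1 - a.sign * Complex.I * fderiv ℝ f z Complex.I) / 2 := by
  cases a <;> simp [wirtinger, dz, dzbar, MetricDerivative.sign]

theorem wirtinger_congr (h : f =ᶠ[𝓝 z] g) : wirtinger a f z = wirtinger a g z := by
  simp only [wirtinger_eq, h.fderiv_eq]

theorem wirtinger_const (c : ℂ) : wirtinger a (fun _ => c) z = 0 := by
  simp [wirtinger_eq]

theorem wirtinger_add (hf : DifferentiableAt ℝ f z) (hg : DifferentiableAt ℝ g z) :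
    wirtinger a (fun w => f w + g w) z = wirtinger a f z + wirtinger a g z := by
  simp only [wirtinger_eq, fderiv_fun_add hf hg, add_apply]
  ring

theorem wirtinger_mul (hf : DifferentiableAt ℝ f z) (hg : DifferentiableAt ℝ g z) :
    wirtinger a (fun w => f w * g w) z = wirtinger a f z * g z + f z * wirtinger a g z := by
  simp only [wirtinger_eq, fderiv_fun_mul hf hg, add_apply, smul_apply, smul_eq_mul]
  ring

theorem wirtinger_const_mul (c : ℂ) (hf : DifferentiableAt ℝ f z) :
    wirtinger a (fun w => c * f w) z = c * wirtinger a f z := by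
  rw [wirtinger_mul (differentiableAt_const c) hf, wirtinger_const]
  ring

theorem hasFDerivAt_comp_of_hasDerivAt {φ' : ℂ} (hφ : HasDerivAt φ φ' (f z))
    (hf : DifferentiableAt ℝ f z) : HasFDerivAt (fun w => φ (f w)) (φ' • fderiv ℝ f z) z :=
  hφ.comp_hasFDerivAt z hf.hasFDerivAt

theorem wirtinger_comp {φ' : ℂ} (hφ : HasDerivAt φ φ' (f z)) (hf : DifferentiableAt ℝ f z) :
    wirtinger a (fun w => φ (f w)) z = φ' * wirtinger a f z := by
  simp only [wirtinger_eq, (hasFDerivAt_comp_of_hasDerivAt hφ hf).fderiv, smul_apply, smul_eq_mul]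
  ring

theorem differentiableAt_zpow_of_ne_zero (n : ℤ) (hf : DifferentiableAt ℝ f z) (h0 : f z ≠ 0) :
    DifferentiableAt ℝ (fun w => f w ^ n) z :=
  (hasFDerivAt_comp_of_hasDerivAt (hasDerivAt_zpow n (f z) (.inl h0)) hf).differentiableAt

theorem wirtinger_zpow (n : ℤ) (hf : DifferentiableAt ℝ f z) (h0 : f z ≠ 0) :
    wirtinger a (fun w => f w ^ n) z = n * f z ^ (n - 1) * wirtinger a f z :=
  wirtinger_comp (hasDerivAt_zpow n (f z) (.inl h0)) hf

theorem wirtinger_pow (n : ℕ) (hf : DifferentiableAt ℝ f z) :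
    wirtinger a (fun w => f w ^ n) z = n * f z ^ (n - 1) * wirtinger a f z :=
  wirtinger_comp (hasDerivAt_pow n (f z)) hf

theorem wirtinger_of_differentiableAt (hh : DifferentiableAt ℂ h z) :
    wirtinger a h z = (1 + a.sign) / 2 * deriv h z := by
  simp only [wirtinger_eq, (hh.hasDerivAt.hasFDerivAt.restrictScalars ℝ).fderiv,
    ContinuousLinearMap.coe_restrictScalars', ContinuousLinearMap.toSpanSingleton_apply,
    smul_eq_mul]
  linear_combination (-a.sign * deriv h z / 2) * Complex.I_sq

theorem hasFDerivAt_conj_of_differentiableAt (hh : DifferentiableAt ℂ h z) :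
    HasFDerivAt (fun w => conj (h w)) ((Complex.conjCLE : ℂ →L[ℝ] ℂ).comp
      ((ContinuousLinearMap.toSpanSingleton ℂ (deriv h z)).restrictScalars ℝ)) z :=
  (Complex.conjCLE : ℂ →L[ℝ] ℂ).hasFDerivAt.comp z
    (hh.hasDerivAt.hasFDerivAt.restrictScalars ℝ)

theorem wirtinger_conj_of_differentiableAt (hh : DifferentiableAt ℂ h z) :
    wirtinger a (fun w => conj (h w)) z = (1 - a.sign) / 2 * conj (deriv h z) := by
  simp only [wirtinger_eq, (hasFDerivAt_conj_of_differentiableAt hh).fderiv,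
    ContinuousLinearMap.comp_apply, ContinuousLinearMap.coe_restrictScalars',
    ContinuousLinearMap.toSpanSingleton_apply, smul_eq_mul, ContinuousLinearEquiv.coe_coe,
    Complex.conjCLE_apply, map_mul, map_one, Complex.conj_I]
  linear_combination (a.sign * conj (deriv h z) / 2) * Complex.I_sq

theorem fderiv_eq_wirtinger (f : ℂ → ℂ) (z v : ℂ) :
    fderiv ℝ f z v = wirtinger .K f z * v + wirtinger .L f z * conj v := by
  obtain ⟨x, y⟩ := v
  have hv : (⟨x, y⟩ : ℂ) = x • (1 : ℂ) + y • Complex.I := by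
    apply Complex.ext <;> simp
  have hconj : conj (x • (1 : ℂ) + y • Complex.I) = x - y * Complex.I := by simp [sub_eq_add_neg]
  rw [hv, hconj, map_add, map_smul, map_smul]
  simp only [wirtinger_eq, MetricDerivative.sign, Complex.real_smul]
  push_cast
  linear_combination (y * fderiv ℝ f z Complex.I) * Complex.I_sq

theorem norm_fderiv_le_wirtinger (f : ℂ → ℂ) (z : ℂ) :
    ‖fderiv ℝ f z‖ ≤ ‖wirtinger .K f z‖ + ‖wirtinger .L f z‖ := by
  refine ContinuousLinearMap.opNorm_le_bound _ (by positivity) fun v => ?_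
  rw [fderiv_eq_wirtinger, add_mul]
  exact (norm_add_le _ _).trans_eq (by simp)

theorem contDiffOn_wirtinger {U : Set ℂ} (hU : IsOpen U) (hf : ContDiffOn ℝ ∞ f U) :
    ContDiffOn ℝ ∞ (wirtinger a f) U := by
  have hf' : ContDiffOn ℝ ∞ (fderiv ℝ f) U := hf.fderiv_of_isOpen hU (by simp)
  have heq : wirtinger a f =
      fun z => (fderiv ℝ f z 1 - a.sign * Complex.I * fderiv ℝ f z Complex.I) / 2 :=
    funext (wirtinger_eq a f)
  rw [heq]
  fun_prop

end Wirtinger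

/-! ### Metric derivatives -/

/-- The metric derivative `K_r` or `L_r` of the metric `(λ |dz|) ^ 2`. -/
def metricOp (lam : ℂ → ℝ) : MetricDerivative → ℤ → (ℂ → ℂ) → ℂ → ℂ
  | .K => opK lam
  | .L => opL lam

/-- A density `λ` on an open set `U` for which `(λ |dz|) ^ 2` is a smooth conformal metric. The
smoothness is imposed on the inverse `λ⁻¹`, by which the metric derivatives are expressed. -/
structure IsConformalDensity (U : Set ℂ) (lam : ℂ → ℝ) : Prop where
  isOpen : IsOpen U
  pos : ∀ z ∈ U, 0 < lam z
  contDiffOn_inv : ContDiffOn ℝ ∞ (fun z => (lam z : ℂ)⁻¹) U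

section MetricOperators

variable {U : Set ℂ} {lam : ℂ → ℝ} {f g : ℂ → ℂ} {z : ℂ}

theorem metricOp_eq_zpow_mul_wirtinger (lam : ℂ → ℝ) (a : MetricDerivative) (r : ℤ) (f : ℂ → ℂ)
    (z : ℂ) : metricOp lam a r f z = (lam z : ℂ) ^ (a.sign * r - 1) *
      wirtinger a (fun w => (lam w : ℂ) ^ (-(a.sign * r)) * f w) z := by
  cases a <;> simp [metricOp, wirtinger, MetricDerivative.sign, opK, opL]

theorem metricOp_congr (hU : IsOpen U) (a : MetricDerivative) (r : ℤ) (h : EqOn f g U) :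
    EqOn (metricOp lam a r f) (metricOp lam a r g) U := fun z hz => by
  simp only [metricOp_eq_zpow_mul_wirtinger]
  congr 1
  refine wirtinger_congr ?_
  filter_upwards [hU.mem_nhds hz] with w hw
  rw [h hw]

theorem iteratedOp_cons (lam : ℂ → ℝ) (a : MetricDerivative) (w : List MetricDerivative) (r : ℤ)
    (f : ℂ → ℂ) :
    iteratedOp lam (a :: w) r f = iteratedOp lam w (r + a.sign) (metricOp lam a r f) := by
  cases a <;> rfl

theorem iteratedOp_congr (hU : IsOpen U) (w : List MetricDerivative) (r : ℤ) (h : EqOn f g U) :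
    EqOn (iteratedOp lam w r f) (iteratedOp lam w r g) U := by
  induction w generalizing r f g with
  | nil => exact h
  | cons a w ih => simpa only [iteratedOp_cons] using ih _ (metricOp_congr hU a r h)

theorem IsConformalDensity.differentiableAt_inv (hlam : IsConformalDensity U lam) (hz : z ∈ U) :
    DifferentiableAt ℝ (fun w => (lam w : ℂ)⁻¹) z :=
  (hlam.contDiffOn_inv.contDiffAt (hlam.isOpen.mem_nhds hz)).differentiableAt (by simp)

theorem IsConformalDensity.metricOp_eq (hlam : IsConformalDensity U lam) (a : MetricDerivative)
    (r : ℤ) (hz : z ∈ U) (hf : DifferentiableAt ℝ f z) :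
    metricOp lam a r f z = (lam z : ℂ)⁻¹ * wirtinger a f z +
      a.sign * r * (wirtinger a (fun w => (lam w : ℂ)⁻¹) z * f z) := by
  have h0 : (lam z : ℂ)⁻¹ ≠ 0 := inv_ne_zero (by exact_mod_cast (hlam.pos z hz).ne')
  have hinv := hlam.differentiableAt_inv hz
  have hpow (w : ℂ) (n : ℤ) : (lam w : ℂ) ^ (-n) = ((lam w : ℂ)⁻¹) ^ n := by
    rw [inv_zpow, zpow_neg]
  rw [metricOp_eq_zpow_mul_wirtinger]
  simp only [hpow]
  rw [wirtinger_mul (differentiableAt_zpow_of_ne_zero _ hinv h0) hf, wirtinger_zpow _ hinv h0]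
  have hcancel : (lam z : ℂ) ^ (a.sign * r - 1) * ((lam z : ℂ)⁻¹) ^ (a.sign * r - 1) = 1 := by
    rw [← mul_zpow, mul_inv_cancel₀ (by simpa using h0), one_zpow]
  have hsucc : ((lam z : ℂ)⁻¹) ^ (a.sign * r) =
      ((lam z : ℂ)⁻¹) ^ (a.sign * r - 1) * (lam z : ℂ)⁻¹ := by
    rw [← zpow_add_one₀ h0, sub_add_cancel]
  rw [hsucc]
  push_cast
  linear_combination ((lam z : ℂ)⁻¹ * wirtinger a f z +
    a.sign * r * (wirtinger a (fun w => (lam w : ℂ)⁻¹) z * f z)) * hcancel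

theorem IsConformalDensity.metricOp_add (hlam : IsConformalDensity U lam) (a : MetricDerivative)
    (r : ℤ) (hz : z ∈ U) (hf : DifferentiableAt ℝ f z) (hg : DifferentiableAt ℝ g z) :
    metricOp lam a r (fun w => f w + g w) z = metricOp lam a r f z + metricOp lam a r g z := by
  rw [hlam.metricOp_eq a r hz hf, hlam.metricOp_eq a r hz hg,
    hlam.metricOp_eq a r hz (hf.fun_add hg), wirtinger_add hf hg]
  ring

theorem IsConformalDensity.norm_fderiv_le (hlam : IsConformalDensity U lam) (hz : z ∈ U)
    (hf : DifferentiableAt ℝ f z) :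
    ‖fderiv ℝ f z‖ ≤ (‖metricOp lam .K 0 f z‖ + ‖metricOp lam .L 0 f z‖) * lam z := by
  have hpos := hlam.pos z hz
  have hwirtinger (a : MetricDerivative) : ‖wirtinger a f z‖ = ‖metricOp lam a 0 f z‖ * lam z := by
    rw [hlam.metricOp_eq a 0 hz hf, Int.cast_zero, mul_zero, zero_mul, add_zero, norm_mul, norm_inv,
      Complex.norm_real, Real.norm_of_nonneg hpos.le]
    field_simp
  rw [add_mul, ← hwirtinger, ← hwirtinger]
  exact norm_fderiv_le_wirtinger f z

end MetricOperators

/-! ### Conjugate jet operators -/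

/-- A class `A` of smooth functions on `U`, each bounded on every disc of radius `ρ < 1`, that is
closed under the operations by which the metric derivatives of `(λ |dz|) ^ 2` act on the
coefficients of a conjugate jet operator. -/
structure IsCoefficientClass (U : Set ℂ) (lam : ℂ → ℝ) (A : (ℂ → ℂ) → Prop) : Prop where
  smooth : ∀ {g}, A g → ContDiffOn ℝ ∞ g U
  add : ∀ {g₁ g₂}, A g₁ → A g₂ → A (fun z => g₁ z + g₂ z)
  const_mul : ∀ (c : ℂ) {g}, A g → A (fun z => c * g z)
  inv_mul : ∀ {g}, A g → A (fun z => (lam z : ℂ)⁻¹ * g z)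
  inv_mul_wirtinger : ∀ (a : MetricDerivative) {g}, A g →
    A (fun z => (lam z : ℂ)⁻¹ * wirtinger a g z)
  wirtinger_inv_mul : ∀ (a : MetricDerivative) {g}, A g →
    A (fun z => wirtinger a (fun w => (lam w : ℂ)⁻¹) z * g z)
  bounded : ∀ {g}, A g → ∀ ρ < 1, ∃ C, ∀ z ∈ U, ‖z‖ ≤ ρ → ‖g z‖ ≤ C

/-- Operators `h ↦ ∑ gᵢ conj (h⁽ⁱ⁾)` on holomorphic functions, with coefficients `gᵢ` in a given
class. -/
inductive JetOp (A : (ℂ → ℂ) → Prop) : ((ℂ → ℂ) → ℂ → ℂ) → Prop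
  | term (g : ℂ → ℂ) (i : ℕ) : A g → JetOp A (fun h z => g z * conj (iteratedDeriv i h z))
  | add (T₁ T₂ : (ℂ → ℂ) → ℂ → ℂ) : JetOp A T₁ → JetOp A T₂ →
      JetOp A (fun h z => T₁ h z + T₂ h z)

theorem norm_iteratedDeriv_le_of_forall_mem_sphere {F : Type*} [NormedAddCommGroup F]
    [NormedSpace ℂ F] [CompleteSpace F] {h : ℂ → F} {c z : ℂ} {ρ σ M : ℝ} (hρσ : ρ < σ)
    (hh : DiffContOnCl ℂ h (ball c σ)) (hM : ∀ w ∈ sphere c σ, ‖h w‖ ≤ M) (i : ℕ)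
    (hz : dist z c ≤ ρ) : ‖iteratedDeriv i h z‖ ≤ i.factorial / (σ - ρ) ^ i * M := by
  have hσ : σ ≠ 0 := (dist_nonneg.trans_lt (hz.trans_lt hρσ)).ne'
  have hsub : ball z (σ - ρ) ⊆ ball c σ := ball_subset_ball' (by linarith)
  have hsphere : sphere z (σ - ρ) ⊆ closure (ball c σ) := by
    rw [closure_ball c hσ]
    exact sphere_subset_closedBall.trans (closedBall_subset_closedBall' (by linarith))
  have hmax : ∀ w ∈ closure (ball c σ), ‖h w‖ ≤ M := fun w hw =>
    Complex.norm_le_of_forall_mem_frontier_norm_le isBounded_ball hh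
      (by rwa [frontier_ball c hσ]) hw
  rw [div_mul_eq_mul_div]
  exact Complex.norm_iteratedDeriv_le_of_forall_mem_sphere_norm_le i (sub_pos.2 hρσ)
    (hh.mono hsub) fun w hw => hmax w (hsphere hw)

section JetOperators

variable {U : Set ℂ} {lam : ℂ → ℝ} {A : (ℂ → ℂ) → Prop} {T : (ℂ → ℂ) → ℂ → ℂ} {h : ℂ → ℂ}
  {z : ℂ}

theorem analyticOnNhd_iteratedDeriv (hU : IsOpen U) (hh : DifferentiableOn ℂ h U) (i : ℕ) :
    AnalyticOnNhd ℂ (iteratedDeriv i h) U := by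
  rw [iteratedDeriv_eq_iterate]
  exact (hh.analyticOnNhd hU).iterated_deriv i

theorem JetOp.contDiffOn (hT : JetOp A T) (hU : IsOpen U) (hA : IsCoefficientClass U lam A)
    (hh : DifferentiableOn ℂ h U) : ContDiffOn ℝ ∞ (T h) U := by
  induction hT with
  | term g i hg =>
    have hderiv : ContDiffOn ℝ ∞ (iteratedDeriv i h) U :=
      ((analyticOnNhd_iteratedDeriv hU hh i).contDiffOn hU.uniqueDiffOn).restrict_scalars ℝ
    exact (hA.smooth hg).mul (Complex.conjCLE.contDiff.comp_contDiffOn hderiv)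
  | add T₁ T₂ _ _ ih₁ ih₂ => exact ih₁.add ih₂

theorem JetOp.differentiableAt (hT : JetOp A T) (hU : IsOpen U) (hA : IsCoefficientClass U lam A)
    (hh : DifferentiableOn ℂ h U) (hz : z ∈ U) : DifferentiableAt ℝ (T h) z :=
  ((hT.contDiffOn hU hA hh).contDiffAt (hU.mem_nhds hz)).differentiableAt (by simp)

theorem IsConformalDensity.metricOp_mul_conj_iteratedDeriv (hlam : IsConformalDensity U lam)
    {g : ℂ → ℂ} (hg : DifferentiableAt ℝ g z) (hh : DifferentiableOn ℂ h U) (hz : z ∈ U)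
    (a : MetricDerivative) (r : ℤ) (i : ℕ) :
    metricOp lam a r (fun w => g w * conj (iteratedDeriv i h w)) z =
      ((lam z : ℂ)⁻¹ * wirtinger a g z +
          a.sign * r * (wirtinger a (fun w => (lam w : ℂ)⁻¹) z * g z)) *
        conj (iteratedDeriv i h z) +
      (1 - a.sign) / 2 * ((lam z : ℂ)⁻¹ * g z) * conj (iteratedDeriv (i + 1) h z) := by
  have hderiv := (analyticOnNhd_iteratedDeriv hlam.isOpen hh i z hz).differentiableAt
  have hconj := (hasFDerivAt_conj_of_differentiableAt hderiv).differentiableAt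
  rw [hlam.metricOp_eq a r hz (hg.fun_mul hconj), wirtinger_mul hg hconj,
    wirtinger_conj_of_differentiableAt hderiv, iteratedDeriv_succ]
  ring

theorem JetOp.exists_metricOp (hT : JetOp A T) (hlam : IsConformalDensity U lam)
    (hA : IsCoefficientClass U lam A) (a : MetricDerivative) (r : ℤ) :
    ∃ T', JetOp A T' ∧ ∀ h, DifferentiableOn ℂ h U →
      EqOn (metricOp lam a r (T h)) (T' h) U := by
  induction hT with
  | term g i hg =>
    refine ⟨_, .add _ _
      (.term _ i (hA.add (hA.inv_mul_wirtinger a hg)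
        (hA.const_mul (a.sign * r) (hA.wirtinger_inv_mul a hg))))
      (.term _ (i + 1) (hA.const_mul ((1 - a.sign) / 2) (hA.inv_mul hg))), fun h hh z hz => ?_⟩
    have hg' := ((hA.smooth hg).contDiffAt (hlam.isOpen.mem_nhds hz)).differentiableAt (by simp)
    exact hlam.metricOp_mul_conj_iteratedDeriv hg' hh hz a r i
  | add T₁ T₂ h₁ h₂ ih₁ ih₂ =>
    obtain ⟨T₁', h₁', heq₁⟩ := ih₁
    obtain ⟨T₂', h₂', heq₂⟩ := ih₂
    refine ⟨_, .add _ _ h₁' h₂', fun h hh z hz => ?_⟩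
    rw [hlam.metricOp_add a r hz (h₁.differentiableAt hlam.isOpen hA hh hz)
      (h₂.differentiableAt hlam.isOpen hA hh hz), heq₁ h hh hz, heq₂ h hh hz]

theorem JetOp.exists_iteratedOp (hT : JetOp A T) (hlam : IsConformalDensity U lam)
    (hA : IsCoefficientClass U lam A) (w : List MetricDerivative) (r : ℤ) :
    ∃ T', JetOp A T' ∧ ∀ h, DifferentiableOn ℂ h U →
      EqOn (iteratedOp lam w r (T h)) (T' h) U := by
  induction w generalizing T r with
  | nil => exact ⟨T, hT, fun h _ => eqOn_refl _ _⟩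
  | cons a w ih =>
    obtain ⟨T₁, h₁, heq₁⟩ := hT.exists_metricOp hlam hA a r
    obtain ⟨T₂, h₂, heq₂⟩ := ih h₁ (r + a.sign)
    refine ⟨T₂, h₂, fun h hh => ?_⟩
    rw [iteratedOp_cons]
    exact (iteratedOp_congr hlam.isOpen w _ (heq₁ h hh)).trans (heq₂ h hh)

theorem JetOp.exists_norm_le (hT : JetOp A T) (hA : IsCoefficientClass U lam A) {ρ σ : ℝ}
    (hρ : ρ < 1) (hρσ : ρ < σ) :
    ∃ C : ℝ≥0, ∀ (h : ℂ → ℂ) (M : ℝ), DiffContOnCl ℂ h (ball 0 σ) →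
      (∀ z ∈ sphere (0 : ℂ) σ, ‖h z‖ ≤ M) → ∀ z ∈ U, ‖z‖ ≤ ρ → ‖T h z‖ ≤ C * M := by
  induction hT with
  | term g i hg =>
    obtain ⟨C, hC⟩ := hA.bounded hg ρ hρ
    have hpos : 0 < σ - ρ := sub_pos.2 hρσ
    refine ⟨Real.toNNReal C * (i.factorial / (σ - ρ).toNNReal ^ i), fun h M hh hM z hz hzρ => ?_⟩
    rw [norm_mul, RCLike.norm_conj]
    push_cast
    rw [Real.coe_toNNReal _ hpos.le, mul_assoc]
    gcongr
    · exact (hC z hz hzρ).trans (Real.le_coe_toNNReal C)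
    · exact norm_iteratedDeriv_le_of_forall_mem_sphere hρσ hh hM i (by simpa using hzρ)
  | add T₁ T₂ _ _ ih₁ ih₂ =>
    obtain ⟨C₁, hC₁⟩ := ih₁
    obtain ⟨C₂, hC₂⟩ := ih₂
    refine ⟨C₁ + C₂, fun h M hh hM z hz hzρ => ?_⟩
    push_cast
    rw [add_mul]
    exact norm_add_le_of_le (hC₁ h M hh hM z hz hzρ) (hC₂ h M hh hM z hz hzρ)

theorem JetOp.exists_norm_fderiv_le (hT : JetOp A T) (hlam : IsConformalDensity U lam)
    (hA : IsCoefficientClass U lam A) {ρ σ : ℝ} (hρ : ρ < 1) (hρσ : ρ < σ) :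
    ∃ C : ℝ≥0, ∀ (h : ℂ → ℂ) (M : ℝ), DifferentiableOn ℂ h U → DiffContOnCl ℂ h (ball 0 σ) →
      (∀ z ∈ sphere (0 : ℂ) σ, ‖h z‖ ≤ M) →
      ∀ z ∈ U, ‖z‖ ≤ ρ → ‖fderiv ℝ (T h) z‖ ≤ C * M * lam z := by
  obtain ⟨T₁, h₁, heq₁⟩ := hT.exists_metricOp hlam hA .K 0
  obtain ⟨T₂, h₂, heq₂⟩ := hT.exists_metricOp hlam hA .L 0
  obtain ⟨C₁, hC₁⟩ := h₁.exists_norm_le hA hρ hρσ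
  obtain ⟨C₂, hC₂⟩ := h₂.exists_norm_le hA hρ hρσ
  refine ⟨C₁ + C₂, fun h M hhU hhσ hM z hz hzρ => ?_⟩
  have hpos := hlam.pos z hz
  refine (hlam.norm_fderiv_le hz (hT.differentiableAt hlam.isOpen hA hhU hz)).trans ?_
  rw [heq₁ h hhU hz, heq₂ h hhU hz]
  push_cast
  rw [add_mul (C₁ : ℝ)]
  gcongr
  · exact hC₁ h M hhσ hM z hz hzρ
  · exact hC₂ h M hhσ hM z hz hzρ

end JetOperators

/-! ### Lengths of paths -/

/-- The length of the path `γ` on `[0, t]` for the metric `(λ |dz|) ^ 2`. -/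
def pathLength (lam : ℂ → ℝ) (γ : ℝ → ℂ) (t : ℝ) : ℝ≥0∞ :=
  ∫⁻ s in Icc (0 : ℝ) t, ENNReal.ofReal (lam (γ s) * ‖deriv γ s‖)

/-- The paths in `U` that start at a point with `|z| < 1 / 2` and have length at most two for the
metric `(λ |dz|) ^ 2` stay in the disc of radius `ρ`. The bound two leaves room for the paths that
only approximate a distance of at most one. -/
def ConfinesShortPaths (U : Set ℂ) (lam : ℂ → ℝ) (ρ : ℝ) : Prop :=
  ∀ γ : ℝ → ℂ, ContDiff ℝ 1 γ → MapsTo γ (Icc 0 1) U → γ 0 ∈ ball 0 (1 / 2) →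
    pathLength lam γ 1 ≤ 2 → ∀ t ∈ Icc (0 : ℝ) 1, ‖γ t‖ ≤ ρ

/-- A height function on `U`: it varies at most as fast as the distance of the metric
`(λ |dz|) ^ 2`, is bounded above on the part `|z| < 1 / 2` of `U`, and tends to infinity
as `|z|` tends to one. -/
structure IsHeight (U : Set ℂ) (lam u : ℂ → ℝ) : Prop where
  contDiffOn : ContDiffOn ℝ 1 u U
  norm_fderiv_le : ∀ z ∈ U, ‖fderiv ℝ u z‖ ≤ lam z
  bddAbove : BddAbove (u '' (U ∩ ball 0 (1 / 2)))
  norm_le_of_le : ∀ b, ∃ ρ < 1, ∀ z ∈ U, u z ≤ b → ‖z‖ ≤ ρ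

section Paths

variable {U : Set ℂ} {lam : ℂ → ℝ}

theorem enorm_sub_le_pathLength {E : Type*} [NormedAddCommGroup E] [NormedSpace ℝ E]
    [CompleteSpace E] (hU : IsOpen U) {G : ℂ → E} (hG : ContDiffOn ℝ 1 G U) {C : ℝ≥0}
    {γ : ℝ → ℂ} (hγ : ContDiff ℝ 1 γ) {t : ℝ} (ht : 0 ≤ t) (hmaps : MapsTo γ (Icc 0 t) U)
    (hC : ∀ s ∈ Icc 0 t, ‖fderiv ℝ G (γ s)‖ ≤ C * lam (γ s)) :
    ‖G (γ t) - G (γ 0)‖ₑ ≤ C * pathLength lam γ t := by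
  have hderiv : ∀ s ∈ uIcc 0 t,
      HasDerivAt (fun s => G (γ s)) (fderiv ℝ G (γ s) (deriv γ s)) s := by
    intro s hs
    rw [uIcc_of_le ht] at hs
    have hGs := (hG.contDiffAt (hU.mem_nhds (hmaps hs))).differentiableAt (by simp)
    exact hGs.hasFDerivAt.comp_hasDerivAt s (hγ.differentiable (by simp) s).hasDerivAt
  have hcont : ContinuousOn (fun s => fderiv ℝ G (γ s) (deriv γ s)) (uIcc 0 t) := by
    rw [uIcc_of_le ht]
    exact ((hG.continuousOn_fderiv_of_isOpen hU le_rfl).comp hγ.continuous.continuousOn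
      hmaps).clm_apply (hγ.continuous_deriv le_rfl).continuousOn
  rw [← intervalIntegral.integral_eq_sub_of_hasDerivAt hderiv hcont.intervalIntegrable,
    intervalIntegral.integral_of_le ht, ← integral_Icc_eq_integral_Ioc, pathLength,
    ← lintegral_const_mul' _ _ ENNReal.coe_ne_top]
  refine (enorm_integral_le_lintegral_enorm _).trans
    (setLIntegral_mono' measurableSet_Icc fun s hs => ?_)
  rw [← ofReal_norm, ← ENNReal.ofReal_coe_nnreal, ← ENNReal.ofReal_mul C.coe_nonneg, ← mul_assoc]
  gcongr
  exact ContinuousLinearMap.le_of_opNorm_le _ (hC s hs) _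

theorem IsHeight.exists_confinesShortPaths {u : ℂ → ℝ} (hu : IsHeight U lam u) (hU : IsOpen U) :
    ∃ ρ < 1, ConfinesShortPaths U lam ρ := by
  obtain ⟨b, hb⟩ := hu.bddAbove
  obtain ⟨ρ, hρ, hle⟩ := hu.norm_le_of_le (b + 2)
  refine ⟨ρ, hρ, fun γ hγ hmaps hγ0 hlen t ht => hle _ (hmaps ht) ?_⟩
  have hsub : Icc 0 t ⊆ Icc (0 : ℝ) 1 := Icc_subset_Icc_right ht.2
  have hvar : ‖u (γ t) - u (γ 0)‖ₑ ≤ 2 :=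
    calc ‖u (γ t) - u (γ 0)‖ₑ ≤ (1 : ℝ≥0) * pathLength lam γ t :=
          enorm_sub_le_pathLength hU hu.contDiffOn hγ ht.1 (hmaps.mono_left hsub)
            fun s hs => by simpa using hu.norm_fderiv_le _ (hmaps (hsub hs))
      _ = pathLength lam γ t := by simp
      _ ≤ pathLength lam γ 1 := lintegral_mono_set hsub
      _ ≤ 2 := hlen
  have hstart : u (γ 0) ≤ b := hb (mem_image_of_mem u ⟨hmaps (by simp), hγ0⟩)
  rw [← ofReal_norm, ENNReal.ofReal_le_ofNat] at hvar
  linarith [le_of_abs_le hvar]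

theorem enorm_sub_le_mul_pathDist (hU : IsOpen U) {ρ : ℝ}
    (hρ : ConfinesShortPaths U lam ρ)
    {E : Type*} [NormedAddCommGroup E] [NormedSpace ℝ E] [CompleteSpace E] {G : ℂ → E}
    (hG : ContDiffOn ℝ 1 G U) {C : ℝ≥0} (hC : ∀ z ∈ U, ‖z‖ ≤ ρ → ‖fderiv ℝ G z‖ ≤ C * lam z)
    {z₁ z₂ : ℂ} (hz₁ : z₁ ∈ ball (0 : ℂ) (1 / 2)) (hd : pathDist U lam z₁ z₂ ≤ 1) :
    ‖G z₁ - G z₂‖ₑ ≤ C * pathDist U lam z₁ z₂ := by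
  have hd2 : pathDist U lam z₁ z₂ < 2 := hd.trans_lt ENNReal.one_lt_two
  rw [mul_comm, ← ENNReal.div_le_iff_le_mul (.inr hd2.ne_top) (.inl ENNReal.coe_ne_top)]
  by_contra! hlt
  obtain ⟨γ, hγ, hmaps, hγ0, hγ1, hlen⟩ : ∃ γ : ℝ → ℂ, ContDiff ℝ 1 γ ∧ MapsTo γ (Icc 0 1) U ∧
      γ 0 = z₁ ∧ γ 1 = z₂ ∧ pathLength lam γ 1 < min (‖G z₁ - G z₂‖ₑ / C) 2 := by
    simpa only [pathDist, pathLength, iInf_lt_iff, exists_prop] using lt_min hlt hd2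
  have hle := enorm_sub_le_pathLength hU hG hγ zero_le_one hmaps fun s hs =>
    hC _ (hmaps hs) (hρ γ hγ hmaps (hγ0 ▸ hz₁) (hlen.le.trans (min_le_right _ _)) s hs)
  rw [hγ0, hγ1, enorm_sub_rev] at hle
  exact (ENNReal.div_le_of_le_mul' hle).not_gt (hlen.trans_le (min_le_left _ _))

end Paths

/-! ### The norm in one chart -/

instance : Finite MetricDerivative :=
  Finite.of_surjective (fun b : Bool => bif b then .K else .L)
    (by rintro (_ | _); exacts [⟨true, rfl⟩, ⟨false, rfl⟩])

section ChartNorm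

variable {U : Set ℂ} {lam : ℂ → ℝ} {A : (ℂ → ℂ) → Prop} {T : (ℂ → ℂ) → ℂ → ℂ} {r : ℤ} {k : ℕ}
  {α : ℝ}

theorem div_rpow_le_of_le_mul {a c d : ℝ≥0∞} (hα : α ≤ 1) (hd : d ≤ 1) (h : a ≤ c * d) :
    a / d ^ α ≤ c := by
  refine ENNReal.div_le_of_le_mul (h.trans ?_)
  gcongr
  simpa using ENNReal.rpow_le_rpow_of_exponent_ge hd hα

theorem chartNorm_le {f : ℂ → ℂ} {B : ℝ≥0∞} (hα : α ≤ 1)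
    (hf : ContDiffOn ℝ k f (U ∩ ball 0 (1 / 2)))
    (hsup : ∀ w : List MetricDerivative, w.length ≤ k →
      ∀ z ∈ U ∩ ball 0 (1 / 2), ‖iteratedOp lam w r f z‖ₑ ≤ B)
    (hlip : ∀ w : List MetricDerivative, w.length = k →
      ∀ z₁ ∈ U ∩ ball 0 (1 / 2), ∀ z₂ ∈ U ∩ ball 0 (1 / 2), pathDist U lam z₁ z₂ ≤ 1 →
        ‖iteratedOp lam w r f z₁ - iteratedOp lam w r f z₂‖ₑ ≤ B * pathDist U lam z₁ z₂) :
    chartNorm U lam r k α f ≤ (k + 2) * B := by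
  have hderiv : ∀ j ∈ Finset.range (k + 1), derivSup (U ∩ ball 0 (1 / 2)) lam r j f ≤ B := by
    intro j hj
    simp only [derivSup, iSup_le_iff]
    exact fun w hw => hsup w (hw.trans_le (Finset.mem_range_succ_iff.1 hj))
  have hholder : holderSup U (U ∩ ball 0 (1 / 2)) lam r k α f ≤ B := by
    simp only [holderSup, iSup_le_iff]
    exact fun w hw z₁ hz₁ z₂ hz₂ hd => div_rpow_le_of_le_mul hα hd (hlip w hw z₁ hz₁ z₂ hz₂ hd)
  rw [chartNorm, if_pos hf]
  refine (add_le_add (Finset.sum_le_sum hderiv) hholder).trans_eq ?_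
  rw [Finset.sum_const, Finset.card_range, nsmul_eq_mul]
  push_cast
  ring

theorem enorm_le_chartNorm (f : ℂ → ℂ) {z : ℂ} (hz : z ∈ U ∩ ball 0 (1 / 2)) :
    ‖f z‖ₑ ≤ chartNorm U lam r k α f := by
  rw [chartNorm]
  split_ifs
  · calc ‖f z‖ₑ ≤ derivSup (U ∩ ball 0 (1 / 2)) lam r 0 f :=
          le_iSup₂_of_le (f := fun w (_ : w.length = 0) => ⨆ z ∈ U ∩ ball 0 (1 / 2),
            ‖iteratedOp lam w r f z‖ₑ) [] rfl
            (le_iSup₂ (f := fun z (_ : z ∈ U ∩ ball 0 (1 / 2)) => ‖f z‖ₑ) z hz)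
      _ ≤ ∑ j ∈ Finset.range (k + 1), derivSup (U ∩ ball 0 (1 / 2)) lam r j f :=
          Finset.single_le_sum_of_canonicallyOrdered
            (f := fun j => derivSup (U ∩ ball 0 (1 / 2)) lam r j f) (by simp)
      _ ≤ _ := le_self_add
  · exact le_top

theorem JetOp.exists_enorm_iteratedOp_le (hT : JetOp A T) (hlam : IsConformalDensity U lam)
    (hA : IsCoefficientClass U lam A) {ρ σ : ℝ} (hρ : ρ < 1) (hρσ : ρ < σ) (r : ℤ)
    (w : List MetricDerivative) :
    ∃ C : ℝ≥0, ∀ (h : ℂ → ℂ) (M : ℝ≥0), DifferentiableOn ℂ h U → DiffContOnCl ℂ h (ball 0 σ) →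
      (∀ z ∈ sphere (0 : ℂ) σ, ‖h z‖ ≤ M) →
      ∀ z ∈ U, ‖z‖ ≤ ρ → ‖iteratedOp lam w r (T h) z‖ₑ ≤ C * M := by
  obtain ⟨T', hT', heq⟩ := hT.exists_iteratedOp hlam hA w r
  obtain ⟨C, hC⟩ := hT'.exists_norm_le hA hρ hρσ
  refine ⟨C, fun h M hhU hhσ hM z hz hzρ => ?_⟩
  rw [heq h hhU hz, ← ENNReal.coe_mul]
  exact enorm_le_coe.2 (hC h M hhσ hM z hz hzρ)

theorem JetOp.exists_enorm_iteratedOp_sub_le (hT : JetOp A T) (hlam : IsConformalDensity U lam)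
    (hA : IsCoefficientClass U lam A) {ρ σ : ℝ} (hconf : ConfinesShortPaths U lam ρ) (hρ : ρ < 1)
    (hρσ : ρ < σ) (r : ℤ) (w : List MetricDerivative) :
    ∃ C : ℝ≥0, ∀ (h : ℂ → ℂ) (M : ℝ≥0), DifferentiableOn ℂ h U → DiffContOnCl ℂ h (ball 0 σ) →
      (∀ z ∈ sphere (0 : ℂ) σ, ‖h z‖ ≤ M) →
      ∀ z₁ ∈ U ∩ ball 0 (1 / 2), ∀ z₂ ∈ U, pathDist U lam z₁ z₂ ≤ 1 →
        ‖iteratedOp lam w r (T h) z₁ - iteratedOp lam w r (T h) z₂‖ₑ ≤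
          C * M * pathDist U lam z₁ z₂ := by
  obtain ⟨T', hT', heq⟩ := hT.exists_iteratedOp hlam hA w r
  obtain ⟨C, hC⟩ := hT'.exists_norm_fderiv_le hlam hA hρ hρσ
  refine ⟨C, fun h M hhU hhσ hM z₁ hz₁ z₂ hz₂ hd => ?_⟩
  rw [heq h hhU hz₁.1, heq h hhU hz₂, ← ENNReal.coe_mul]
  refine enorm_sub_le_mul_pathDist hlam.isOpen hconf
    ((hT'.contDiffOn hlam.isOpen hA hhU).of_le (by simp)) (fun z hz hzρ => ?_) hz₁.2 hd
  push_cast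
  exact hC h M hhU hhσ hM z hz hzρ

theorem JetOp.exists_chartNorm_le (hT : JetOp A T) (hlam : IsConformalDensity U lam)
    (hA : IsCoefficientClass U lam A) {ρ σ : ℝ} (hconf : ConfinesShortPaths U lam ρ) (hρ : ρ < 1)
    (hρσ : ρ < σ) (hσ : 1 / 2 < σ) (r : ℤ) (k : ℕ) (hα : α ≤ 1) :
    ∃ C : ℝ≥0, ∀ (h F : ℂ → ℂ) (M : ℝ≥0), DifferentiableOn ℂ h U →
      DiffContOnCl ℂ h (ball 0 σ) → (∀ z ∈ sphere (0 : ℂ) σ, ‖h z‖ ≤ M) → EqOn F (T h) U →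
      chartNorm U lam r k α F ≤ C * M := by
  choose Csup hsup using
    hT.exists_enorm_iteratedOp_le hlam hA (by norm_num : (1 / 2 : ℝ) < 1) hσ r
  choose Clip hlip using hT.exists_enorm_iteratedOp_sub_le hlam hA hconf hρ hρσ r
  have hfin := List.finite_length_le MetricDerivative k
  obtain ⟨B₁, hB₁⟩ := (hfin.image Csup).bddAbove
  obtain ⟨B₂, hB₂⟩ := (hfin.image Clip).bddAbove
  refine ⟨(k + 2) * max B₁ B₂, fun h F M hhU hhσ hM hF => ?_⟩
  have hiter (w) : EqOn (iteratedOp lam w r F) (iteratedOp lam w r (T h)) U :=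
    iteratedOp_congr hlam.isOpen w r hF
  have hsmooth : ContDiffOn ℝ k F (U ∩ ball 0 (1 / 2)) :=
    (((hT.contDiffOn hlam.isOpen hA hhU).of_le (by exact_mod_cast le_top)).congr hF).mono
      inter_subset_left
  push_cast
  rw [mul_assoc]
  refine chartNorm_le hα hsmooth (fun w hw z hz => ?_) fun w hw z₁ hz₁ z₂ hz₂ hd => ?_
  · rw [hiter w hz.1]
    refine (hsup w h M hhU hhσ hM z hz.1 (mem_ball_zero_iff.1 hz.2).le).trans ?_
    gcongr
    exact le_max_of_le_left (ENNReal.coe_le_coe.2 (hB₁ (mem_image_of_mem Csup hw)))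
  · rw [hiter w hz₁.1, hiter w hz₂.1]
    refine (hlip w h M hhU hhσ hM z₁ hz₁ z₂ hz₂.1 hd).trans ?_
    gcongr
    exact le_max_of_le_right (ENNReal.coe_le_coe.2 (hB₂ (mem_image_of_mem Clip hw.le)))

theorem exists_chartNorm_le_of_eqOn_mul_conj (hlam : IsConformalDensity U lam)
    (hA : IsCoefficientClass U lam A) {ρ : ℝ} (hconf : ConfinesShortPaths U lam ρ) (hρ : ρ < 1)
    (hU : U ⊆ ball 0 1) (hsphere : ∀ σ ∈ Ioo (0 : ℝ) 1, sphere 0 σ ⊆ U) {g : ℂ → ℂ} (hg : A g)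
    (hg0 : ∀ z ∈ U, g z ≠ 0) (r : ℤ) (k : ℕ) (hα : α ≤ 1) :
    ∃ C : ℝ≥0, ∀ (h F : ℂ → ℂ) (M : ℝ≥0), DifferentiableOn ℂ h (ball 0 1) →
      EqOn F (fun z => g z * conj (h z)) U → (∀ z ∈ U, ‖F z‖ ≤ M) →
      chartNorm U lam r k α F ≤ C * M := by
  obtain ⟨σ, hσ, hσ1⟩ := exists_between (max_lt hρ (by norm_num : (1 / 2 : ℝ) < 1))
  obtain ⟨hρσ, h2σ⟩ := max_lt_iff.1 hσ
  have hσU : sphere 0 σ ⊆ U := hsphere σ ⟨by linarith, hσ1⟩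
  obtain ⟨B, hB⟩ := (isCompact_sphere (0 : ℂ) σ).exists_bound_of_continuousOn
    (((hA.smooth hg).continuousOn.mono hσU).inv₀ fun z hz => hg0 z (hσU hz))
  obtain ⟨C, hC⟩ := (JetOp.term g 0 hg).exists_chartNorm_le hlam hA hconf hρ hρσ h2σ r k hα
  refine ⟨C * B.toNNReal, fun h F M hh hF hM => ?_⟩
  have hhσ : DiffContOnCl ℂ h (ball 0 σ) :=
    (hh.mono (closure_ball_subset_closedBall.trans (closedBall_subset_ball hσ1))).diffContOnCl
  rw [ENNReal.coe_mul, mul_assoc, ← ENNReal.coe_mul]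
  refine hC h F _ (hh.mono hU) hhσ (fun z hz => ?_) (by simpa only [iteratedDeriv_zero] using hF)
  have hhz : conj (h z) = (g z)⁻¹ * F z := by
    rw [hF (hσU hz), inv_mul_cancel_left₀ (hg0 z (hσU hz))]
  rw [← RCLike.norm_conj, hhz, norm_mul]
  push_cast
  gcongr
  · exact (hB z hz).trans (Real.le_coe_toNNReal B)
  · exact hM z (hσU hz)

theorem exists_enorm_le_of_eqOn_mul_conj (hA : IsCoefficientClass U lam A) {g h F : ℂ → ℂ}
    (hg : A g) (hh : DifferentiableOn ℂ h (ball 0 1)) (hF : EqOn F (fun z => g z * conj (h z)) U) :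
    ∃ B : ℝ≥0, ∀ z ∈ U ∩ ball 0 (1 / 2), ‖F z‖ₑ ≤ B := by
  obtain ⟨C, hC⟩ := hA.bounded hg (1 / 2) (by norm_num)
  obtain ⟨D, hD⟩ := (isCompact_closedBall (0 : ℂ) (1 / 2)).exists_bound_of_continuousOn
    (hh.continuousOn.mono (closedBall_subset_ball (by norm_num)))
  refine ⟨C.toNNReal * D.toNNReal, fun z hz => enorm_le_coe.2 ?_⟩
  have hz2 : ‖z‖ ≤ 1 / 2 := (mem_ball_zero_iff.1 hz.2).le
  rw [hF hz.1, nnnorm_mul, RCLike.nnnorm_conj]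
  gcongr
  · exact NNReal.le_toNNReal_of_coe_le (hC z hz.1 hz2)
  · exact NNReal.le_toNNReal_of_coe_le (hD z (by simpa using hz2))

end ChartNorm

/-! ### Derivatives of radial functions -/

section NormDerivatives

variable {z : ℂ}

theorem hasFDerivAt_norm_sq (z : ℂ) :
    HasFDerivAt (fun w : ℂ => ‖w‖ ^ 2) ((2 : ℝ) • innerSL ℝ z) z := by
  simpa [two_smul] using (hasStrictFDerivAt_norm_sq z).hasFDerivAt

theorem hasFDerivAt_norm (hz : z ≠ 0) :
    HasFDerivAt (fun w : ℂ => ‖w‖) ((‖z‖⁻¹ : ℝ) • innerSL ℝ z) z := by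
  have h := (hasFDerivAt_norm_sq z).sqrt (by simpa using hz)
  simp only [Real.sqrt_sq (norm_nonneg _)] at h
  rwa [smul_smul, one_div, mul_inv, mul_right_comm, inv_mul_cancel₀ two_ne_zero, one_mul] at h

theorem hasFDerivAt_log_norm (hz : z ≠ 0) :
    HasFDerivAt (fun w : ℂ => Real.log ‖w‖) (((‖z‖ ^ 2)⁻¹ : ℝ) • innerSL ℝ z) z := by
  have h := (hasFDerivAt_norm hz).log (norm_ne_zero_iff.2 hz)
  rwa [smul_smul, ← mul_inv, ← pow_two] at h

theorem wirtinger_ofReal_of_hasFDerivAt {f : ℂ → ℝ} {c : ℝ} (h : HasFDerivAt f (c • innerSL ℝ z) z)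
    (a : MetricDerivative) :
    wirtinger a (fun w => (f w : ℂ)) z = c * ‖z‖ * (z / ‖z‖) ^ (-a.sign) / 2 := by
  have hconj : (‖z‖ : ℂ) * (z / ‖z‖)⁻¹ = conj z := by
    rcases eq_or_ne z 0 with rfl | hz
    · simp
    rw [inv_div, mul_div, div_eq_iff hz, ← sq, ← Complex.conj_mul']
  have hself : (‖z‖ : ℂ) * (z / ‖z‖) = z := mul_div_cancel_of_imp' (by simp)
  have hf : HasFDerivAt (fun w => (f w : ℂ)) (Complex.ofRealCLM.comp (c • innerSL ℝ z)) z :=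
    Complex.ofRealCLM.hasFDerivAt.comp z h
  rw [wirtinger_eq, hf.fderiv, mul_assoc (c : ℂ)]
  cases a
  · rw [MetricDerivative.sign, zpow_neg_one, hconj]
    apply Complex.ext <;> simp [Complex.inner]
  · rw [MetricDerivative.sign, neg_neg, zpow_one, hself]
    apply Complex.ext <;> simp [Complex.inner]

end NormDerivatives

/-! ### The hyperbolic disc -/

section DiscModel

theorem one_sub_norm_sq_pos {z : ℂ} (hz : z ∈ disc) : 0 < 1 - ‖z‖ ^ 2 := by
  have : ‖z‖ < 1 := mem_ball_zero_iff.1 hz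
  nlinarith [norm_nonneg z]

theorem isConformalDensity_disc : IsConformalDensity disc discDensity where
  isOpen := isOpen_ball
  pos _ hz := div_pos two_pos (one_sub_norm_sq_pos hz)
  contDiffOn_inv := by
    have heq : (fun z => (discDensity z : ℂ)⁻¹) = fun z => (((1 - ‖z‖ ^ 2) / 2 : ℝ) : ℂ) := by
      funext z
      rw [discDensity, ← Complex.ofReal_inv, inv_div]
    rw [heq]
    exact (Complex.ofRealCLM.contDiff.comp
      ((contDiff_const.sub (contDiff_norm_sq ℝ)).div_const 2)).contDiffOn

theorem isCoefficientClass_disc :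
    IsCoefficientClass disc discDensity (fun g => ContDiffOn ℝ ∞ g disc) where
  smooth h := h
  add h₁ h₂ := h₁.add h₂
  const_mul _ _ h := contDiffOn_const.mul h
  inv_mul h := isConformalDensity_disc.contDiffOn_inv.mul h
  inv_mul_wirtinger _ _ h :=
    isConformalDensity_disc.contDiffOn_inv.mul (contDiffOn_wirtinger isOpen_ball h)
  wirtinger_inv_mul _ _ h :=
    (contDiffOn_wirtinger isOpen_ball isConformalDensity_disc.contDiffOn_inv).mul h
  bounded {g} h ρ hρ := by
    obtain ⟨C, hC⟩ := (isCompact_closedBall (0 : ℂ) ρ).exists_bound_of_continuousOn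
      (h.continuousOn.mono (closedBall_subset_ball hρ))
    exact ⟨C, fun z _ hz => hC z (by simpa using hz)⟩

theorem norm_fderiv_disc_height_le {z : ℂ} (hz : z ∈ disc) :
    ‖fderiv ℝ (fun z : ℂ => -Real.log (1 - ‖z‖ ^ 2)) z‖ ≤ discDensity z := by
  have hpos := one_sub_norm_sq_pos hz
  have hderiv := (((hasFDerivAt_norm_sq z).const_sub 1).log hpos.ne').fun_neg
  rw [hderiv.fderiv, norm_neg, norm_smul, norm_neg, norm_smul, innerSL_apply_norm, discDensity,
    Real.norm_of_nonneg (inv_nonneg.2 hpos.le), Real.norm_two, inv_mul_eq_div]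
  gcongr
  linarith [mem_ball_zero_iff.1 hz]

theorem isHeight_disc : IsHeight disc discDensity (fun z => -Real.log (1 - ‖z‖ ^ 2)) where
  contDiffOn := ((contDiff_const.sub (contDiff_norm_sq ℝ)).contDiffOn.log
    fun z hz => (one_sub_norm_sq_pos hz).ne').neg
  norm_fderiv_le _ := norm_fderiv_disc_height_le
  bddAbove := by
    refine ⟨-Real.log (3 / 4), forall_mem_image.2 fun z hz => ?_⟩
    have hz2 : ‖z‖ < 1 / 2 := mem_ball_zero_iff.1 hz.2
    gcongr
    nlinarith [norm_nonneg z]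
  norm_le_of_le b := by
    refine ⟨√(1 - Real.exp (-b)), ?_, fun z hz hb => Real.le_sqrt_of_sq_le ?_⟩
    · rw [Real.sqrt_lt' one_pos]
      linarith [Real.exp_pos (-b)]
    · have : Real.exp (-b) ≤ 1 - ‖z‖ ^ 2 := by
        rw [← Real.le_log_iff_exp_le (one_sub_norm_sq_pos hz)]
        linarith
      linarith

theorem exists_chartNorm_disc_le {α : ℝ} (r : ℤ) (k : ℕ) (hα : α ≤ 1) :
    ∃ C : ℝ≥0, ∀ (h F : ℂ → ℂ) (M : ℝ≥0), DifferentiableOn ℂ h disc →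
      EqOn F (fun z => ((discDensity z : ℂ)⁻¹) ^ 2 * conj (h z)) disc →
      (∀ z ∈ disc, ‖F z‖ ≤ M) → chartNorm disc discDensity r k α F ≤ C * M := by
  obtain ⟨ρ, hρ, hconf⟩ := isHeight_disc.exists_confinesShortPaths isOpen_ball
  refine exists_chartNorm_le_of_eqOn_mul_conj isConformalDensity_disc isCoefficientClass_disc hconf
    hρ subset_rfl (fun σ hσ => sphere_subset_ball hσ.2)
    (isConformalDensity_disc.contDiffOn_inv.pow 2) (fun z hz => ?_) r k hα
  have : (discDensity z : ℂ) ≠ 0 := by exact_mod_cast (isConformalDensity_disc.pos z hz).ne'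
  positivity

end DiscModel

/-! ### The hyperbolic punctured disc -/

/-- The monomials `u ^ n |z| ^ d (log |z|) ^ m` in polar coordinates, with `u = z / |z|`. -/
def cuspMonomial (n d : ℤ) (m : ℕ) (z : ℂ) : ℂ :=
  (z / ‖z‖) ^ n * (‖z‖ : ℂ) ^ d * (Real.log ‖z‖ : ℂ) ^ m

/-- The linear combinations on the punctured disc of the monomials `u ^ n |z| ^ d (log |z|) ^ m`
with `d ≥ 1`: the factor `|z| ^ d` outweighs the logarithms at the puncture. -/
inductive CuspCoefficient : (ℂ → ℂ) → Prop
  | monomial (c : ℂ) (n d : ℤ) (m : ℕ) : 1 ≤ d →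
      CuspCoefficient (fun z => c * cuspMonomial n d m z)
  | add (g₁ g₂ : ℂ → ℂ) : CuspCoefficient g₁ → CuspCoefficient g₂ →
      CuspCoefficient (fun z => g₁ z + g₂ z)
  | congr (g₁ g₂ : ℂ → ℂ) : CuspCoefficient g₁ → EqOn g₂ g₁ puncturedDisc → CuspCoefficient g₂

section CuspMonomials

variable {a : MetricDerivative} {z : ℂ}

theorem div_norm_ne_zero (hz : z ≠ 0) : z / (‖z‖ : ℂ) ≠ 0 := div_ne_zero hz (by simpa using hz)

theorem contDiffAt_ofReal_norm {n : WithTop ℕ∞} (hz : z ≠ 0) :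
    ContDiffAt ℝ n (fun w => (‖w‖ : ℂ)) z :=
  Complex.ofRealCLM.contDiff.contDiffAt.comp z (contDiffAt_norm ℝ hz)

theorem contDiffAt_log_norm {n : WithTop ℕ∞} (hz : z ≠ 0) :
    ContDiffAt ℝ n (fun w : ℂ => Real.log ‖w‖) z :=
  (contDiffAt_norm ℝ hz).log (norm_ne_zero_iff.2 hz)

theorem contDiffAt_ofReal_log_norm {n : WithTop ℕ∞} (hz : z ≠ 0) :
    ContDiffAt ℝ n (fun w => (Real.log ‖w‖ : ℂ)) z :=
  Complex.ofRealCLM.contDiff.contDiffAt.comp z (contDiffAt_log_norm hz)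

theorem contDiffAt_div_norm {n : WithTop ℕ∞} (hz : z ≠ 0) :
    ContDiffAt ℝ n (fun w => w / (‖w‖ : ℂ)) z := by
  have hnorm : (‖z‖ : ℂ) ≠ 0 := by simpa using hz
  exact contDiffAt_id.mul ((contDiffAt_ofReal_norm hz).inv hnorm)

theorem contDiffAt_zpow_of_ne_zero {f : ℂ → ℂ} {n : WithTop ℕ∞} (hf : ContDiffAt ℝ n f z)
    (h0 : f z ≠ 0) (k : ℤ) : ContDiffAt ℝ n (fun w => f w ^ k) z := by
  cases k with
  | ofNat k => simpa using hf.pow k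
  | negSucc k =>
    simp only [zpow_negSucc]
    exact (hf.pow (k + 1)).inv (pow_ne_zero _ h0)

theorem contDiffAt_cuspMonomial (n d : ℤ) (m : ℕ) (hz : z ≠ 0) :
    ContDiffAt ℝ ∞ (cuspMonomial n d m) z :=
  ((contDiffAt_zpow_of_ne_zero (contDiffAt_div_norm hz) (div_norm_ne_zero hz) n).mul
    (contDiffAt_zpow_of_ne_zero (contDiffAt_ofReal_norm hz) (by simpa using hz) d)).mul
    ((contDiffAt_ofReal_log_norm hz).pow m)

theorem cuspMonomial_mul (n d n' d' : ℤ) (m m' : ℕ) (hz : z ≠ 0) :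
    cuspMonomial n d m z * cuspMonomial n' d' m' z =
      cuspMonomial (n + n') (d + d') (m + m') z := by
  have hnorm : (‖z‖ : ℂ) ≠ 0 := by simpa using hz
  simp only [cuspMonomial, zpow_add₀ (div_norm_ne_zero hz), zpow_add₀ hnorm, pow_add]
  ring

theorem wirtinger_norm (hz : z ≠ 0) :
    wirtinger a (fun w => (‖w‖ : ℂ)) z = (z / ‖z‖) ^ (-a.sign) / 2 := by
  rw [wirtinger_ofReal_of_hasFDerivAt (hasFDerivAt_norm hz), Complex.ofReal_inv,
    inv_mul_cancel₀ (by simpa using hz), one_mul]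

theorem wirtinger_log_norm (hz : z ≠ 0) :
    wirtinger a (fun w => (Real.log ‖w‖ : ℂ)) z = (z / ‖z‖) ^ (-a.sign) * (‖z‖ : ℂ)⁻¹ / 2 := by
  have hnorm : (‖z‖ : ℂ) ≠ 0 := by simpa using hz
  rw [wirtinger_ofReal_of_hasFDerivAt (hasFDerivAt_log_norm hz)]
  push_cast
  field_simp

theorem wirtinger_div_norm (hz : z ≠ 0) : wirtinger a (fun w => w / (‖w‖ : ℂ)) z =
    a.sign / 2 * (z / ‖z‖) ^ (1 - a.sign) * (‖z‖ : ℂ)⁻¹ := by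
  have hnorm : (‖z‖ : ℂ) ≠ 0 := by simpa using hz
  have hdiff : DifferentiableAt ℝ (fun w : ℂ => (‖w‖ : ℂ)) z :=
    (contDiffAt_ofReal_norm (n := 1) hz).differentiableAt (by simp)
  simp only [div_eq_mul_inv, ← zpow_neg_one (‖_‖ : ℂ)]
  rw [wirtinger_mul (f := fun w => w) differentiableAt_id
    (differentiableAt_zpow_of_ne_zero (-1) hdiff hnorm),
    wirtinger_of_differentiableAt differentiableAt_fun_id, wirtinger_zpow (-1) hdiff hnorm,
    wirtinger_norm hz, deriv_id'']
  cases a <;> simp only [MetricDerivative.sign] <;> push_cast <;> field_simp <;> norm_num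

theorem wirtinger_cuspMonomial (n d : ℤ) (m : ℕ) (hz : z ≠ 0) :
    wirtinger a (cuspMonomial n d m) z =
      (d + a.sign * n) / 2 * cuspMonomial (n - a.sign) (d - 1) m z +
        m / 2 * cuspMonomial (n - a.sign) (d - 1) (m - 1) z := by
  have hnorm : (‖z‖ : ℂ) ≠ 0 := by simpa using hz
  have hu := div_norm_ne_zero hz
  have hdu := (contDiffAt_div_norm (n := 1) hz).differentiableAt (by simp)
  have hdnorm := (contDiffAt_ofReal_norm (n := 1) hz).differentiableAt (by simp)
  have hdlog := (contDiffAt_ofReal_log_norm (n := 1) hz).differentiableAt (by simp)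
  have hdu' := differentiableAt_zpow_of_ne_zero n hdu hu
  have hdnorm' := differentiableAt_zpow_of_ne_zero d hdnorm hnorm
  unfold cuspMonomial
  rw [wirtinger_mul (hdu'.fun_mul hdnorm') (hdlog.fun_pow m), wirtinger_mul hdu' hdnorm',
    wirtinger_zpow n hdu hu, wirtinger_zpow d hdnorm hnorm, wirtinger_pow m hdlog,
    wirtinger_div_norm hz, wirtinger_norm hz, wirtinger_log_norm hz]
  simp only [sub_eq_add_neg, zpow_add₀ hu, zpow_add₀ hnorm, zpow_one, zpow_neg_one]
  field_simp
  ring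

end CuspMonomials

section PuncturedDisc

variable {z : ℂ}

theorem isOpen_puncturedDisc : IsOpen puncturedDisc := isOpen_ball.sdiff isClosed_singleton

theorem norm_pos_of_mem_puncturedDisc (hz : z ∈ puncturedDisc) : 0 < ‖z‖ := norm_pos_iff.2 hz.2

theorem norm_lt_one_of_mem_puncturedDisc (hz : z ∈ puncturedDisc) : ‖z‖ < 1 :=
  mem_ball_zero_iff.1 hz.1

theorem log_norm_neg (hz : z ∈ puncturedDisc) : Real.log ‖z‖ < 0 :=
  Real.log_neg (norm_pos_of_mem_puncturedDisc hz) (norm_lt_one_of_mem_puncturedDisc hz)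

theorem cuspDensity_inv_eq (hz : z ∈ puncturedDisc) :
    (cuspDensity z : ℂ)⁻¹ = -1 * cuspMonomial 0 1 1 z := by
  simp [cuspDensity, cuspMonomial, abs_of_neg (log_norm_neg hz)]

theorem wirtinger_cuspDensity_inv (a : MetricDerivative) (hz : z ∈ puncturedDisc) :
    wirtinger a (fun w => (cuspDensity w : ℂ)⁻¹) z =
      -1 / 2 * cuspMonomial (-a.sign) 0 1 z + -1 / 2 * cuspMonomial (-a.sign) 0 0 z := by
  have heq : (fun w => (cuspDensity w : ℂ)⁻¹) =ᶠ[𝓝 z] fun w => -1 * cuspMonomial 0 1 1 w := by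
    filter_upwards [isOpen_puncturedDisc.mem_nhds hz] with w hw using cuspDensity_inv_eq hw
  rw [wirtinger_congr heq, wirtinger_const_mul _
    ((contDiffAt_cuspMonomial 0 1 1 hz.2).differentiableAt (by simp)),
    wirtinger_cuspMonomial 0 1 1 hz.2, zero_sub, sub_self, Nat.sub_self]
  push_cast
  ring

theorem isConformalDensity_cusp : IsConformalDensity puncturedDisc cuspDensity where
  isOpen := isOpen_puncturedDisc
  pos _ hz := inv_pos.2 (mul_pos (norm_pos_of_mem_puncturedDisc hz)
    (abs_pos.2 (log_norm_neg hz).ne))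
  contDiffOn_inv := by
    refine ContDiffOn.congr (fun z hz => ?_) fun z hz => cuspDensity_inv_eq hz
    exact (contDiffAt_const.mul (contDiffAt_cuspMonomial 0 1 1 hz.2)).contDiffWithinAt

theorem norm_cuspMonomial_le (n : ℤ) {d : ℤ} (m : ℕ) (hd : 1 ≤ d) (hz : z ∈ puncturedDisc) :
    ‖cuspMonomial n d m z‖ ≤ m.factorial := by
  have hpos := norm_pos_of_mem_puncturedDisc hz
  have hlog := log_norm_neg hz
  have hlog_pow : (-Real.log ‖z‖) ^ m ≤ m.factorial * ‖z‖⁻¹ := by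
    have := Real.pow_div_factorial_le_exp (-Real.log ‖z‖) (by linarith) m
    rwa [Real.exp_neg, Real.exp_log hpos, div_le_iff₀' (by positivity)] at this
  have hzpow : ‖z‖ ^ d ≤ ‖z‖ := by
    simpa using zpow_le_zpow_right_of_le_one₀ hpos (norm_lt_one_of_mem_puncturedDisc hz).le hd
  calc ‖cuspMonomial n d m z‖ = ‖z‖ ^ d * (-Real.log ‖z‖) ^ m := by
        simp [cuspMonomial, norm_zpow, abs_of_neg hlog, hpos.ne']
    _ ≤ ‖z‖ * (m.factorial * ‖z‖⁻¹) := by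
        have := pow_nonneg (neg_nonneg.2 hlog.le) m
        gcongr
    _ = m.factorial := by field_simp

end PuncturedDisc

section CuspCoefficients

variable {g : ℂ → ℂ}

theorem CuspCoefficient.contDiffOn (hg : CuspCoefficient g) : ContDiffOn ℝ ∞ g puncturedDisc := by
  induction hg with
  | monomial c n d m _ =>
    exact fun z hz => (contDiffAt_const.mul (contDiffAt_cuspMonomial n d m hz.2)).contDiffWithinAt
  | add g₁ g₂ _ _ ih₁ ih₂ => exact ih₁.add ih₂
  | congr g₁ g₂ _ h ih => exact ih.congr h

theorem CuspCoefficient.differentiableAt (hg : CuspCoefficient g) {z : ℂ}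
    (hz : z ∈ puncturedDisc) : DifferentiableAt ℝ g z :=
  (hg.contDiffOn.contDiffAt (isOpen_puncturedDisc.mem_nhds hz)).differentiableAt (by simp)

theorem CuspCoefficient.monomial_mul (hg : CuspCoefficient g) (c : ℂ) (n : ℤ) {d : ℤ} (m : ℕ)
    (hd : 0 ≤ d) : CuspCoefficient (fun z => c * cuspMonomial n d m z * g z) := by
  induction hg with
  | monomial c' n' d' m' hd' =>
    refine .congr _ _ (.monomial (c * c') (n + n') (d + d') (m + m') (by lia)) fun z hz => ?_
    rw [mul_mul_mul_comm, cuspMonomial_mul _ _ _ _ _ _ hz.2]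
  | add g₁ g₂ _ _ ih₁ ih₂ => exact .congr _ _ (.add _ _ ih₁ ih₂) fun z _ => mul_add _ _ _
  | congr g₁ g₂ _ h ih => exact .congr _ _ ih fun z hz => by simp only [h hz]

theorem CuspCoefficient.inv_mul (hg : CuspCoefficient g) :
    CuspCoefficient (fun z => (cuspDensity z : ℂ)⁻¹ * g z) :=
  .congr _ _ (hg.monomial_mul (-1) 0 1 zero_le_one) fun z hz => by
    simp only [cuspDensity_inv_eq hz]

theorem CuspCoefficient.wirtinger_inv_mul (hg : CuspCoefficient g) (a : MetricDerivative) :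
    CuspCoefficient (fun z => wirtinger a (fun w => (cuspDensity w : ℂ)⁻¹) z * g z) :=
  .congr _ _ (.add _ _ (hg.monomial_mul (-1 / 2) (-a.sign) 1 le_rfl)
      (hg.monomial_mul (-1 / 2) (-a.sign) 0 le_rfl)) fun z hz => by
    simp only [wirtinger_cuspDensity_inv a hz, add_mul]

theorem CuspCoefficient.inv_mul_wirtinger (hg : CuspCoefficient g) (a : MetricDerivative) :
    CuspCoefficient (fun z => (cuspDensity z : ℂ)⁻¹ * wirtinger a g z) := by
  induction hg with
  | monomial c n d m hd =>
    refine .congr _ _ (.add _ _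
      (.monomial (-c * ((d + a.sign * n) / 2)) (0 + (n - a.sign)) (1 + (d - 1)) (1 + m) (by lia))
      (.monomial (-c * (m / 2)) (0 + (n - a.sign)) (1 + (d - 1)) (1 + (m - 1)) (by lia)))
      fun z hz => ?_
    simp only [cuspDensity_inv_eq hz, ← cuspMonomial_mul _ _ _ _ _ _ hz.2,
      wirtinger_const_mul c ((contDiffAt_cuspMonomial n d m hz.2).differentiableAt (by simp)),
      wirtinger_cuspMonomial n d m hz.2]
    ring
  | add g₁ g₂ h₁ h₂ ih₁ ih₂ =>
    refine .congr _ _ (.add _ _ ih₁ ih₂) fun z hz => ?_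
    simp only [wirtinger_add (h₁.differentiableAt hz) (h₂.differentiableAt hz), mul_add]
  | congr g₁ g₂ _ h ih =>
    refine .congr _ _ ih fun z hz => ?_
    simp only [wirtinger_congr (h.eventuallyEq_of_mem (isOpen_puncturedDisc.mem_nhds hz))]

theorem CuspCoefficient.exists_norm_le (hg : CuspCoefficient g) :
    ∃ C, ∀ z ∈ puncturedDisc, ‖g z‖ ≤ C := by
  induction hg with
  | monomial c n d m hd =>
    refine ⟨‖c‖ * m.factorial, fun z hz => ?_⟩
    rw [norm_mul]
    gcongr
    exact norm_cuspMonomial_le n m hd hz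
  | add g₁ g₂ _ _ ih₁ ih₂ =>
    obtain ⟨C₁, hC₁⟩ := ih₁
    obtain ⟨C₂, hC₂⟩ := ih₂
    exact ⟨C₁ + C₂, fun z hz => norm_add_le_of_le (hC₁ z hz) (hC₂ z hz)⟩
  | congr g₁ g₂ _ h ih =>
    obtain ⟨C, hC⟩ := ih
    exact ⟨C, fun z hz => (h hz).symm ▸ hC z hz⟩

theorem isCoefficientClass_cusp : IsCoefficientClass puncturedDisc cuspDensity CuspCoefficient where
  smooth h := h.contDiffOn
  add h₁ h₂ := .add _ _ h₁ h₂
  const_mul c _ h := .congr _ _ (h.monomial_mul c 0 0 le_rfl) fun z _ => by simp [cuspMonomial]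
  inv_mul h := h.inv_mul
  inv_mul_wirtinger a _ h := h.inv_mul_wirtinger a
  wirtinger_inv_mul a _ h := h.wirtinger_inv_mul a
  bounded h ρ _ := by
    obtain ⟨C, hC⟩ := h.exists_norm_le
    exact ⟨C, fun z hz _ => hC z hz⟩

end CuspCoefficients

section CuspModel

theorem norm_fderiv_cusp_height_le {z : ℂ} (hz : z ∈ puncturedDisc) :
    ‖fderiv ℝ (fun z : ℂ => -Real.log (-Real.log ‖z‖)) z‖ ≤ cuspDensity z := by
  have hpos := norm_pos_of_mem_puncturedDisc hz
  have hlog := log_norm_neg hz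
  have hlog0 : -Real.log ‖z‖ ≠ 0 := neg_ne_zero.2 hlog.ne
  have hderiv := ((hasFDerivAt_log_norm hz.2).fun_neg.log hlog0).fun_neg
  rw [hderiv.fderiv, norm_neg, norm_smul, norm_neg, norm_smul, innerSL_apply_norm, cuspDensity,
    abs_of_neg hlog, norm_inv, norm_inv, norm_neg, Real.norm_of_nonpos hlog.le,
    Real.norm_of_nonneg (by positivity)]
  field_simp
  exact le_rfl

theorem isHeight_cusp :
    IsHeight puncturedDisc cuspDensity (fun z => -Real.log (-Real.log ‖z‖)) where
  contDiffOn z hz := ((contDiffAt_log_norm hz.2).neg.log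
    (neg_ne_zero.2 (log_norm_neg hz).ne)).neg.contDiffWithinAt
  norm_fderiv_le _ := norm_fderiv_cusp_height_le
  bddAbove := by
    refine ⟨-Real.log (Real.log 2), forall_mem_image.2 fun z hz => ?_⟩
    have hlog : Real.log ‖z‖ ≤ Real.log (1 / 2) :=
      Real.log_le_log (norm_pos_of_mem_puncturedDisc hz.1) (mem_ball_zero_iff.1 hz.2).le
    rw [one_div, Real.log_inv] at hlog
    gcongr
    linarith
  norm_le_of_le b := by
    refine ⟨Real.exp (-Real.exp (-b)), by simp [Real.exp_pos], fun z hz hb => ?_⟩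
    rw [← Real.log_le_iff_le_exp (norm_pos_of_mem_puncturedDisc hz), le_neg,
      ← Real.le_log_iff_exp_le (neg_pos.2 (log_norm_neg hz))]
    linarith

theorem cuspCoefficient_cuspMonomial (n : ℤ) {d : ℤ} (m : ℕ) (hd : 1 ≤ d) :
    CuspCoefficient (cuspMonomial n d m) :=
  .congr _ _ (.monomial 1 n d m hd) fun _ _ => (one_mul _).symm

theorem exists_chartNorm_cusp_le {α : ℝ} (r : ℤ) (k : ℕ) (hα : α ≤ 1) :
    ∃ C : ℝ≥0, ∀ (h F : ℂ → ℂ) (M : ℝ≥0), DifferentiableOn ℂ h disc →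
      EqOn F (fun z => cuspMonomial 1 1 2 z * conj (h z)) puncturedDisc →
      (∀ z ∈ puncturedDisc, ‖F z‖ ≤ M) → chartNorm puncturedDisc cuspDensity r k α F ≤ C * M := by
  obtain ⟨ρ, hρ, hconf⟩ := isHeight_cusp.exists_confinesShortPaths isOpen_puncturedDisc
  refine exists_chartNorm_le_of_eqOn_mul_conj isConformalDensity_cusp isCoefficientClass_cusp hconf
    hρ sdiff_subset (fun σ hσ z hz => ⟨sphere_subset_ball hσ.2 hz, ?_⟩)
    (cuspCoefficient_cuspMonomial 1 2 le_rfl) (fun z hz => ?_) r k hα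
  · exact ne_of_mem_sphere hz hσ.1.ne'
  · have hz0 : z ≠ 0 := hz.2
    simp [cuspMonomial, (log_norm_neg hz).ne, hz0]

end CuspModel

/-! ### Pullbacks of differentials to the plane -/

section Poles

theorem exists_differentiableOn_eqOn_sub_mul {F : ℂ → ℂ} {U : Set ℂ} {z₀ : ℂ} (hU : U ∈ 𝓝 z₀)
    (hF : DifferentiableOn ℂ F (U \ {z₀})) (hmer : MeromorphicAt F z₀)
    (hord : -1 ≤ meromorphicOrderAt F z₀) :
    ∃ h : ℂ → ℂ, DifferentiableOn ℂ h U ∧ EqOn h (fun z => (z - z₀) * F z) (U \ {z₀}) := by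
  have hsub : MeromorphicAt (fun z => z - z₀) z₀ := by fun_prop
  have hsub_ord : meromorphicOrderAt (fun z => z - z₀) z₀ = 1 :=
    (meromorphicOrderAt_eq_int_iff hsub).2 ⟨fun _ => 1, analyticAt_const, one_ne_zero, by simp⟩
  have hprod_ord : 0 ≤ meromorphicOrderAt (fun z => (z - z₀) * F z) z₀ := by
    rw [fun_meromorphicOrderAt_mul hsub hmer, hsub_ord]
    exact add_le_add_right hord 1
  obtain ⟨y, hy⟩ := (tendsto_nhds_iff_meromorphicOrderAt_nonneg (hsub.fun_mul hmer)).2 hprod_ord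
  have heq : EqOn (Function.update (fun z => (z - z₀) * F z) z₀ y) (fun z => (z - z₀) * F z)
      (U \ {z₀}) := fun z hz => Function.update_of_ne hz.2 _ _
  refine ⟨_, (Complex.differentiableOn_compl_singleton_and_continuousAt_iff hU).1
    ⟨DifferentiableOn.congr ?_ heq, continuousAt_update_same.2 hy⟩, heq⟩
  exact (differentiableOn_id.sub_const z₀).mul hF

end Poles

section Pullback

variable {X : Type u} [TopologicalSpace X] {f : ℂ → X} {z : ℂ} {e : OpenPartialHomeomorph X ℂ}

theorem eventuallyEq_symm_comp (hf : ContinuousAt f z) (hz : f z ∈ e.source) :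
    f =ᶠ[𝓝 z] e.symm ∘ (e ∘ f) := by
  filter_upwards [hf.preimage_mem_nhds (e.open_source.mem_nhds hz)] with w hw
  exact (e.left_inv hw).symm

variable [ChartedSpace ℂ X] {m n : ℤ} {S : Set ℂ}

theorem Differential.toFun_zero (hm : m ≠ 0) (σ : Differential X m n) (x : X) :
    σ.toFun x 0 = 0 := by
  simpa [zero_zpow m hm] using σ.homogeneous x 0 0

theorem Differential.mfderiv_one_ne_zero (hm : m ≠ 0) {σ : Differential X m n}
    (h : σ.pullback f z ≠ 0) : mfderiv 𝓘(ℂ, ℂ) 𝓘(ℂ, ℂ) f z (1 : ℂ) ≠ 0 := fun h0 =>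
  h (by rw [Differential.pullback, h0]; exact σ.toFun_zero hm _)

theorem mfderiv_one_congr {f' : ℂ → X} (h : f =ᶠ[𝓝 z] f') :
    (mfderiv 𝓘(ℂ, ℂ) 𝓘(ℂ, ℂ) f z (1 : ℂ) : ℂ) = mfderiv 𝓘(ℂ, ℂ) 𝓘(ℂ, ℂ) f' z (1 : ℂ) :=
  congrArg (fun L : ℂ →L[ℂ] ℂ => L 1) h.mfderiv_eq

theorem eventually_mdifferentiableAt_and_mem_source (hS : IsOpen S)
    (hf : MDifferentiableOn 𝓘(ℂ, ℂ) 𝓘(ℂ, ℂ) f S) (hz : z ∈ S) (hze : f z ∈ e.source) :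
    ∀ᶠ w in 𝓝 z, MDifferentiableAt 𝓘(ℂ, ℂ) 𝓘(ℂ, ℂ) f w ∧ f w ∈ e.source := by
  have hcont : ContinuousAt f z := (hf.mdifferentiableAt (hS.mem_nhds hz)).continuousAt
  filter_upwards [hS.mem_nhds hz, hcont.preimage_mem_nhds (e.open_source.mem_nhds hze)]
    with w hw hwe
  exact ⟨hf.mdifferentiableAt (hS.mem_nhds hw), hwe⟩

variable [IsManifold 𝓘(ℂ, ℂ) ω X]

theorem differentiableAt_chart_comp (hf : MDifferentiableAt 𝓘(ℂ, ℂ) 𝓘(ℂ, ℂ) f z)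
    (he : e ∈ atlas ℂ X) (hz : f z ∈ e.source) : DifferentiableAt ℂ (e ∘ f) z := by
  have : IsManifold 𝓘(ℂ, ℂ) 1 X := .of_le (n := ω) le_top
  exact mdifferentiableAt_iff_differentiableAt.1 ((mdifferentiableAt_atlas he hz).comp z hf)

theorem mfderiv_one_eq_deriv_smul (hf : MDifferentiableAt 𝓘(ℂ, ℂ) 𝓘(ℂ, ℂ) f z)
    (he : e ∈ atlas ℂ X) (hz : f z ∈ e.source) :
    (mfderiv 𝓘(ℂ, ℂ) 𝓘(ℂ, ℂ) f z (1 : ℂ) : ℂ) =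
      deriv (e ∘ f) z • (mfderiv 𝓘(ℂ, ℂ) 𝓘(ℂ, ℂ) e.symm ((e ∘ f) z) (1 : ℂ) : ℂ) := by
  have : IsManifold 𝓘(ℂ, ℂ) 1 X := .of_le (n := ω) le_top
  have hsymm : MDifferentiableAt 𝓘(ℂ, ℂ) 𝓘(ℂ, ℂ) e.symm ((e ∘ f) z) :=
    mdifferentiableAt_atlas_symm he (e.map_source hz)
  let L : ℂ →L[ℂ] ℂ := mfderiv 𝓘(ℂ, ℂ) 𝓘(ℂ, ℂ) e.symm ((e ∘ f) z)
  have hchain : (mfderiv 𝓘(ℂ, ℂ) 𝓘(ℂ, ℂ) (e.symm ∘ (e ∘ f)) z : ℂ →L[ℂ] ℂ) =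
      L.comp (fderiv ℂ (e ∘ f) z) := by
    rw [← mfderiv_eq_fderiv]
    exact mfderiv_comp z hsymm
      (mdifferentiableAt_iff_differentiableAt.2 (differentiableAt_chart_comp hf he hz))
  have hlin : L (fderiv ℂ (e ∘ f) z 1) = deriv (e ∘ f) z • L 1 := by
    rw [← map_smul, smul_eq_mul, mul_one, fderiv_apply_one_eq_deriv]
  exact (mfderiv_one_congr (eventuallyEq_symm_comp hf.continuousAt hz)).trans
    ((congrArg (fun L : ℂ →L[ℂ] ℂ => L 1) hchain).trans hlin)

theorem Differential.pullback_eq_chart (σ : Differential X m n)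
    (hf : MDifferentiableAt 𝓘(ℂ, ℂ) 𝓘(ℂ, ℂ) f z) (he : e ∈ atlas ℂ X) (hz : f z ∈ e.source) :
    σ.pullback f z =
      deriv (e ∘ f) z ^ m * conj (deriv (e ∘ f) z) ^ n * σ.pullback e.symm ((e ∘ f) z) := by
  have hpoint : f z = e.symm ((e ∘ f) z) := (e.left_inv hz).symm
  exact (congrArg₂ (fun (x : X) (v : ℂ) => σ.toFun x v) hpoint
    (mfderiv_one_eq_deriv_smul hf he hz)).trans (σ.homogeneous _ _ _)

theorem deriv_chart_comp_ne_zero (hf : MDifferentiableAt 𝓘(ℂ, ℂ) 𝓘(ℂ, ℂ) f z)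
    (he : e ∈ atlas ℂ X) (hz : f z ∈ e.source) (h : mfderiv 𝓘(ℂ, ℂ) 𝓘(ℂ, ℂ) f z ≠ 0) :
    deriv (e ∘ f) z ≠ 0 := fun h0 => h <| by
  refine ContinuousLinearMap.ext_ring (R₁ := ℂ) ((mfderiv_one_eq_deriv_smul hf he hz).trans ?_)
  rw [h0, zero_smul]
  rfl

theorem analyticAt_chart_comp (hS : IsOpen S) (hf : MDifferentiableOn 𝓘(ℂ, ℂ) 𝓘(ℂ, ℂ) f S)
    (hz : z ∈ S) (he : e ∈ atlas ℂ X) (hze : f z ∈ e.source) : AnalyticAt ℂ (e ∘ f) z := by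
  rw [Complex.analyticAt_iff_eventually_differentiableAt]
  filter_upwards [eventually_mdifferentiableAt_and_mem_source hS hf hz hze] with w hw
  exact differentiableAt_chart_comp hw.1 he hw.2

theorem image_mem_nhds_of_mfderiv_ne_zero (hS : IsOpen S)
    (hf : MDifferentiableOn 𝓘(ℂ, ℂ) 𝓘(ℂ, ℂ) f S) (hz : z ∈ S)
    (h : mfderiv 𝓘(ℂ, ℂ) 𝓘(ℂ, ℂ) f z ≠ 0) {s : Set ℂ} (hs : s ∈ 𝓝 z) : f '' s ∈ 𝓝 (f z) := by
  set e := chartAt ℂ (f z)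
  have he : e ∈ atlas ℂ X := chart_mem_atlas ℂ (f z)
  have hze : f z ∈ e.source := mem_chart_source ℂ (f z)
  have hfz := hf.mdifferentiableAt (hS.mem_nhds hz)
  have hchart : Filter.map (e ∘ f) (𝓝 z) = 𝓝 ((e ∘ f) z) :=
    (analyticAt_chart_comp hS hf hz he hze).hasStrictDerivAt.map_nhds_eq
      (deriv_chart_comp_ne_zero hfz he hze h)
  have hmap : Filter.map f (𝓝 z) = 𝓝 (f z) := by
    rw [Filter.map_congr (eventuallyEq_symm_comp hfz.continuousAt hze), ← Filter.map_map, hchart]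
    exact e.symm_map_nhds_eq hze
  rw [← hmap]
  exact Filter.image_mem_map hs

theorem Differential.pullback_quadratic_eventuallyEq (q : Differential X 2 0) (hS : IsOpen S)
    (hf : MDifferentiableOn 𝓘(ℂ, ℂ) 𝓘(ℂ, ℂ) f S) (hz : z ∈ S) (he : e ∈ atlas ℂ X)
    (hze : f z ∈ e.source) :
    q.pullback f =ᶠ[𝓝 z] deriv (e ∘ f) ^ 2 * q.pullback e.symm ∘ (e ∘ f) := by
  filter_upwards [eventually_mdifferentiableAt_and_mem_source hS hf hz hze] with w hw
  rw [q.pullback_eq_chart hw.1 he hw.2, zpow_zero, mul_one]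
  rfl

variable {P : Set X} {q : Differential X 2 0}

theorem IsHolomorphicQuadratic.differentiableOn_pullback (hq : IsHolomorphicQuadratic P q)
    (hS : IsOpen S) (hf : MDifferentiableOn 𝓘(ℂ, ℂ) 𝓘(ℂ, ℂ) f S) (hmaps : MapsTo f S Pᶜ) :
    DifferentiableOn ℂ (q.pullback f) S := fun z hz => by
  set e := chartAt ℂ (f z)
  have he : e ∈ atlas ℂ X := chart_mem_atlas ℂ (f z)
  have hze : f z ∈ e.source := mem_chart_source ℂ (f z)
  have hg := analyticAt_chart_comp hS hf hz he hze
  have hmem {w : ℂ} (hw : w ∈ S) (hwe : f w ∈ e.source) :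
      (e ∘ f) w ∈ e.target ∩ e.symm ⁻¹' Pᶜ := by
    refine ⟨e.map_source hwe, ?_⟩
    simpa only [mem_preimage, Function.comp_apply, e.left_inv hwe] using hmaps hw
  have hnear : ∀ᶠ w in 𝓝 z, w ∈ S ∧ f w ∈ e.source :=
    (hS.eventually_mem hz).and
      ((eventually_mdifferentiableAt_and_mem_source hS hf hz hze).mono fun _ h => h.2)
  have hQ : DifferentiableAt ℂ (q.pullback e.symm ∘ (e ∘ f)) z := by
    have hcomp : DifferentiableWithinAt ℂ (q.pullback e.symm ∘ (e ∘ f))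
        {w | w ∈ S ∧ f w ∈ e.source} z :=
      (hq.holomorphic e (IsManifold.chart_mem_maximalAtlas _) _ (hmem hz hze)).comp z
        hg.differentiableAt.differentiableWithinAt fun w hw => hmem hw.1 hw.2
    exact hcomp.differentiableAt hnear
  exact (((hg.deriv.differentiableAt.pow 2).mul hQ).congr_of_eventuallyEq
    (q.pullback_quadratic_eventuallyEq hS hf hz he hze)).differentiableWithinAt

theorem IsHolomorphicQuadratic.meromorphicAt_pullback (hq : IsHolomorphicQuadratic P q)
    (hS : IsOpen S) (hf : MDifferentiableOn 𝓘(ℂ, ℂ) 𝓘(ℂ, ℂ) f S) (hz : z ∈ S) (hzP : f z ∈ P)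
    (himm : mfderiv 𝓘(ℂ, ℂ) 𝓘(ℂ, ℂ) f z ≠ 0) :
    MeromorphicAt (q.pullback f) z ∧ -1 ≤ meromorphicOrderAt (q.pullback f) z := by
  set e := chartAt ℂ (f z)
  have he : e ∈ atlas ℂ X := chart_mem_atlas ℂ (f z)
  have hze : f z ∈ e.source := mem_chart_source ℂ (f z)
  have hg := analyticAt_chart_comp hS hf hz he hze
  have hg' := deriv_chart_comp_ne_zero (hf.mdifferentiableAt (hS.mem_nhds hz)) he hze himm
  obtain ⟨hQ, hQord⟩ := hq.simple_pole e (IsManifold.chart_mem_maximalAtlas _) (f z) hzP hze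
  have heq := (q.pullback_quadratic_eventuallyEq hS hf hz he hze).filter_mono
    (nhdsWithin_le_nhds (s := {z}ᶜ))
  constructor
  · have hQg : MeromorphicAt (q.pullback e.symm ∘ (e ∘ f)) z :=
      MeromorphicAt.comp_analyticAt (x := z) (g := e ∘ f) hQ hg
    exact ((hg.deriv.meromorphicAt.pow 2).mul hQg).congr heq.symm
  · rw [meromorphicOrderAt_congr heq,
      meromorphicOrderAt_mul_of_ne_zero (hg.deriv.pow 2) (pow_ne_zero 2 hg'),
      meromorphicOrderAt_comp_of_deriv_ne_zero hg hg']
    exact hQord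

end Pullback

/-! ### Harmonic Beltrami differentials in uniformizing charts -/

section Harmonic

variable {X : Type u} [TopologicalSpace X] [ChartedSpace ℂ X] {P : Set X} {Λ : Differential X 1 1}
  {μ : Differential X (-1) 1} {f c : ℂ → X} {z : ℂ}

theorem IsDiscChart.mfderiv_one_ne_zero (hf : IsDiscChart P Λ f) (hz : z ∈ disc) :
    mfderiv 𝓘(ℂ, ℂ) 𝓘(ℂ, ℂ) f z (1 : ℂ) ≠ 0 := by
  refine Λ.mfderiv_one_ne_zero one_ne_zero ?_
  rw [hf.isometric z hz, Complex.ofReal_ne_zero]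
  exact pow_ne_zero 2 (isConformalDensity_disc.pos z hz).ne'

theorem IsCuspChart.mfderiv_one_ne_zero (hc : IsCuspChart P Λ c) (hz : z ∈ puncturedDisc) :
    mfderiv 𝓘(ℂ, ℂ) 𝓘(ℂ, ℂ) c z (1 : ℂ) ≠ 0 := by
  refine Λ.mfderiv_one_ne_zero one_ne_zero ?_
  rw [hc.isometric z hz, Complex.ofReal_ne_zero]
  exact pow_ne_zero 2 (isConformalDensity_cusp.pos z hz).ne'

theorem IsCuspChart.mfderiv_ne_zero (hc : IsCuspChart P Λ c) (hz : z ∈ disc) :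
    mfderiv 𝓘(ℂ, ℂ) 𝓘(ℂ, ℂ) c z ≠ 0 := by
  rcases eq_or_ne z 0 with rfl | hz0
  · exact hc.immersive
  · exact fun h => hc.mfderiv_one_ne_zero ⟨hz, hz0⟩ (by rw [h]; rfl)

theorem enorm_pullback_le_supNorm (μ : Differential X (-1) 1) (hz : f z ∈ Pᶜ) :
    ‖μ.pullback f z‖ₑ ≤ supNorm P μ :=
  (le_iSup (fun v : TangentSpace 𝓘(ℂ, ℂ) (f z) => ‖μ.toFun (f z) v‖ₑ) _).trans
    (le_iSup₂ (f := fun (x : X) (_ : x ∈ Pᶜ) =>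
      ⨆ v : TangentSpace 𝓘(ℂ, ℂ) x, ‖μ.toFun x v‖ₑ) (f z) hz)

theorem enorm_toFun_le_enorm_pullback (μ : Differential X (-1) 1)
    (h : mfderiv 𝓘(ℂ, ℂ) 𝓘(ℂ, ℂ) f z (1 : ℂ) ≠ 0) (v : TangentSpace 𝓘(ℂ, ℂ) (f z)) :
    ‖μ.toFun (f z) v‖ₑ ≤ ‖μ.pullback f z‖ₑ := by
  have exists_smul_eq (u w : ℂ) (hw : w ≠ 0) : ∃ a : ℂ, a • w = u := ⟨u / w, div_mul_cancel₀ u hw⟩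
  obtain ⟨a, rfl⟩ : ∃ a : ℂ, a • mfderiv 𝓘(ℂ, ℂ) 𝓘(ℂ, ℂ) f z (1 : ℂ) = v :=
    exists_smul_eq v _ h
  rcases eq_or_ne a 0 with rfl | ha
  · rw [zero_smul, μ.toFun_zero (by norm_num), enorm_zero]
    exact zero_le
  · rw [μ.homogeneous, enorm_le_iff_norm_le, norm_mul, norm_mul, zpow_neg_one, zpow_one,
      RCLike.norm_conj, norm_inv, inv_mul_cancel₀ (norm_ne_zero_iff.2 ha), one_mul]
    rfl

theorem supNorm_le_holderNorm (A : UniformizingAtlas P Λ) (k : ℕ) (α : ℝ)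
    (μ : Differential X (-1) 1) : supNorm P μ ≤ holderNorm A k α μ := by
  refine iSup₂_le fun x hx => iSup_le fun v => ?_
  rcases A.covers x hx with ⟨f, hf, z, hz, rfl⟩ | ⟨c, hc, z, hz, rfl⟩
  · refine le_sup_of_le_left (le_iSup₂_of_le f hf ?_)
    exact (enorm_toFun_le_enorm_pullback μ ((A.isDiscChart f hf).mfderiv_one_ne_zero hz.1) v).trans
      (enorm_le_chartNorm _ hz)
  · refine le_sup_of_le_right (le_iSup₂_of_le c hc ?_)
    exact (enorm_toFun_le_enorm_pullback μ ((A.isCuspChart c hc).mfderiv_one_ne_zero hz.1) v).trans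
      (enorm_le_chartNorm _ hz)

variable [IsManifold 𝓘(ℂ, ℂ) ω X]

theorem IsHarmonic.exists_eqOn_disc (hμ : IsHarmonic P Λ μ) (hf : IsDiscChart P Λ f) :
    ∃ h : ℂ → ℂ, DifferentiableOn ℂ h disc ∧
      EqOn (μ.pullback f) (fun z => ((discDensity z : ℂ)⁻¹) ^ 2 * conj (h z)) disc := by
  obtain ⟨q, hq, hμq⟩ := hμ
  refine ⟨q.pullback f, hq.differentiableOn_pullback isOpen_ball hf.holomorphic hf.mapsTo,
    fun z hz => (hμq _ (hf.mapsTo hz) _).trans ?_⟩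
  change conj (q.pullback f z) / Λ.pullback f z = (discDensity z : ℂ)⁻¹ ^ 2 * conj (q.pullback f z)
  rw [hf.isometric z hz, inv_pow, inv_mul_eq_div, Complex.ofReal_pow]

theorem IsHolomorphicQuadratic.exists_eqOn_cusp {q : Differential X 2 0}
    (hq : IsHolomorphicQuadratic P q) (hc : IsCuspChart P Λ c) :
    ∃ h : ℂ → ℂ, DifferentiableOn ℂ h disc ∧
      EqOn h (fun z => z * q.pullback c z) puncturedDisc := by
  have h0 : (0 : ℂ) ∈ disc := mem_ball_self one_pos
  have hdiff : DifferentiableOn ℂ (q.pullback c) puncturedDisc :=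
    hq.differentiableOn_pullback isOpen_puncturedDisc (hc.holomorphic.mono sdiff_subset) hc.mapsTo
  obtain ⟨hmer, hord⟩ := hq.meromorphicAt_pullback isOpen_ball hc.holomorphic h0 hc.zero_mem
    hc.immersive
  simpa only [disc, puncturedDisc, sub_zero] using
    exists_differentiableOn_eqOn_sub_mul (isOpen_ball.mem_nhds h0) hdiff hmer hord

theorem IsHarmonic.exists_eqOn_cusp (hμ : IsHarmonic P Λ μ) (hc : IsCuspChart P Λ c) :
    ∃ h : ℂ → ℂ, DifferentiableOn ℂ h disc ∧
      EqOn (μ.pullback c) (fun z => cuspMonomial 1 1 2 z * conj (h z)) puncturedDisc := by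
  obtain ⟨q, hq, hμq⟩ := hμ
  obtain ⟨h, hh, heq⟩ := hq.exists_eqOn_cusp hc
  refine ⟨h, hh, fun z hz => (hμq _ (hc.mapsTo hz) _).trans ?_⟩
  change conj (q.pullback c z) / Λ.pullback c z = cuspMonomial 1 1 2 z * conj (h z)
  have hnorm : (‖z‖ : ℂ) ≠ 0 := by exact_mod_cast (norm_pos_of_mem_puncturedDisc hz).ne'
  have hself : z * conj z = (‖z‖ : ℂ) ^ 2 := Complex.mul_conj' z
  rw [hc.isometric z hz, heq hz, Complex.ofReal_pow, ← inv_mul_eq_div, ← inv_pow,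
    cuspDensity_inv_eq hz]
  simp only [cuspMonomial, map_mul, zpow_zero, zpow_one, pow_one]
  field_simp
  linear_combination (-(Real.log ‖z‖ : ℂ) ^ 2 * conj (q.pullback c z)) * hself

end Harmonic

/-! ### Comparison of the norms -/

section Comparison

variable {X : Type u} [TopologicalSpace X] [ChartedSpace ℂ X] [IsManifold 𝓘(ℂ, ℂ) ω X]
  {P : Set X} {Λ : Differential X 1 1} {μ : Differential X (-1) 1} {f c : ℂ → X}

theorem IsHarmonic.exists_enorm_le_disc (hμ : IsHarmonic P Λ μ) (hf : IsDiscChart P Λ f) :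
    ∃ B : ℝ≥0, ∀ y ∈ f '' ball 0 (1 / 2), ∀ v, ‖μ.toFun y v‖ₑ ≤ B := by
  obtain ⟨h, hh, heq⟩ := hμ.exists_eqOn_disc hf
  obtain ⟨B, hB⟩ := exists_enorm_le_of_eqOn_mul_conj isCoefficientClass_disc
    (isConformalDensity_disc.contDiffOn_inv.pow 2) hh heq
  refine ⟨B, forall_mem_image.2 fun z hz v => ?_⟩
  have hzd : z ∈ disc := ball_subset_ball (by norm_num) hz
  exact (enorm_toFun_le_enorm_pullback μ (hf.mfderiv_one_ne_zero hzd) v).trans (hB z ⟨hzd, hz⟩)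

theorem IsHarmonic.exists_enorm_le_cusp (hμ : IsHarmonic P Λ μ) (hc : IsCuspChart P Λ c) :
    ∃ B : ℝ≥0, ∀ y ∈ c '' ball 0 (1 / 2), y ∈ Pᶜ → ∀ v, ‖μ.toFun y v‖ₑ ≤ B := by
  obtain ⟨h, hh, heq⟩ := hμ.exists_eqOn_cusp hc
  obtain ⟨B, hB⟩ := exists_enorm_le_of_eqOn_mul_conj isCoefficientClass_cusp
    (cuspCoefficient_cuspMonomial 1 2 le_rfl) hh heq
  refine ⟨B, forall_mem_image.2 fun z hz hzP v => ?_⟩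
  have hzd : z ∈ puncturedDisc := by
    refine ⟨ball_subset_ball (by norm_num) hz, ?_⟩
    rintro rfl
    exact hzP hc.zero_mem
  exact (enorm_toFun_le_enorm_pullback μ (hc.mfderiv_one_ne_zero hzd) v).trans (hB z ⟨hzd, hz⟩)

theorem IsDiscChart.image_mem_nhds (hf : IsDiscChart P Λ f) {z : ℂ} (hz : z ∈ ball 0 (1 / 2)) :
    f '' ball 0 (1 / 2) ∈ 𝓝 (f z) := by
  have hzd : z ∈ disc := ball_subset_ball (by norm_num) hz
  exact image_mem_nhds_of_mfderiv_ne_zero isOpen_ball hf.holomorphic hzd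
    (fun h => hf.mfderiv_one_ne_zero hzd (by rw [h]; rfl)) (isOpen_ball.mem_nhds hz)

theorem IsCuspChart.image_mem_nhds (hc : IsCuspChart P Λ c) {z : ℂ} (hz : z ∈ ball 0 (1 / 2)) :
    c '' ball 0 (1 / 2) ∈ 𝓝 (c z) := by
  have hzd : z ∈ disc := ball_subset_ball (by norm_num) hz
  exact image_mem_nhds_of_mfderiv_ne_zero isOpen_ball hc.holomorphic hzd
    (hc.mfderiv_ne_zero hzd) (isOpen_ball.mem_nhds hz)

theorem UniformizingAtlas.exists_mem_nhds_image (A : UniformizingAtlas P Λ) (x : X) :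
    (∃ f ∈ A.discs, f '' ball 0 (1 / 2) ∈ 𝓝 x) ∨ ∃ c ∈ A.cusps, c '' ball 0 (1 / 2) ∈ 𝓝 x := by
  by_cases hx : x ∈ P
  · obtain ⟨c, hc, rfl⟩ := A.exists_cusp x hx
    exact .inr ⟨c, hc, (A.isCuspChart c hc).image_mem_nhds (mem_ball_self (by norm_num))⟩
  · refine (A.covers x hx).imp ?_ ?_
    · rintro ⟨f, hf, z, hz, rfl⟩
      exact ⟨f, hf, (A.isDiscChart f hf).image_mem_nhds hz.2⟩
    · rintro ⟨c, hc, z, hz, rfl⟩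
      exact ⟨c, hc, (A.isCuspChart c hc).image_mem_nhds hz.2⟩

theorem IsHarmonic.exists_mem_nhds_enorm_le (hμ : IsHarmonic P Λ μ) (A : UniformizingAtlas P Λ)
    (x : X) : ∃ N ∈ 𝓝 x, ∃ B : ℝ≥0, ∀ y ∈ N, y ∈ Pᶜ → ∀ v, ‖μ.toFun y v‖ₑ ≤ B := by
  rcases A.exists_mem_nhds_image x with ⟨f, hf, hN⟩ | ⟨c, hc, hN⟩
  · obtain ⟨B, hB⟩ := hμ.exists_enorm_le_disc (A.isDiscChart f hf)
    exact ⟨_, hN, B, fun y hy _ => hB y hy⟩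
  · exact ⟨_, hN, hμ.exists_enorm_le_cusp (A.isCuspChart c hc)⟩

theorem IsHarmonic.supNorm_lt_top [CompactSpace X] (hμ : IsHarmonic P Λ μ)
    (A : UniformizingAtlas P Λ) : supNorm P μ < ⊤ := by
  choose N hN B hB using hμ.exists_mem_nhds_enorm_le A
  obtain ⟨t, ht⟩ := CompactSpace.elim_nhds_subcover N hN
  refine lt_of_le_of_lt (b := ((t.sup B : ℝ≥0) : ℝ≥0∞)) ?_ ENNReal.coe_lt_top
  refine iSup₂_le fun y hy => iSup_le fun v => ?_
  obtain ⟨x, hx, hyx⟩ := mem_iUnion₂.1 (ht.ge (mem_univ y))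
  exact (hB x y hyx hy v).trans (ENNReal.coe_le_coe.2 (Finset.le_sup hx))

theorem exists_holderNorm_le_mul_supNorm {α : ℝ} (k : ℕ) (hα : α ≤ 1) :
    ∃ C : ℝ≥0, 0 < C ∧
      ∀ (X : Type u) [TopologicalSpace X] [ChartedSpace ℂ X] [IsManifold 𝓘(ℂ, ℂ) ω X]
        (P : Set X) (Λ : Differential X 1 1) (A : UniformizingAtlas P Λ)
        (μ : Differential X (-1) 1), IsHarmonic P Λ μ →
          holderNorm A k α μ ≤ C * supNorm P μ := by
  obtain ⟨C₁, hC₁⟩ := exists_chartNorm_disc_le (-2) k hα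
  obtain ⟨C₂, hC₂⟩ := exists_chartNorm_cusp_le (-2) k hα
  refine ⟨max 1 (max C₁ C₂), by positivity, fun X _ _ _ P Λ A μ hμ => ?_⟩
  rcases eq_or_ne (supNorm P μ) ⊤ with htop | hfin
  · rw [htop, ENNReal.mul_top (by simp)]
    exact le_top
  lift supNorm P μ to ℝ≥0 using hfin with M hM
  have hbound {f : ℂ → X} {z : ℂ} (hz : f z ∈ Pᶜ) : ‖μ.pullback f z‖ ≤ M :=
    enorm_le_coe.1 (hM ▸ enorm_pullback_le_supNorm μ hz)
  refine sup_le (iSup₂_le fun f hf => ?_) (iSup₂_le fun c hc => ?_)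
  · have hchart := A.isDiscChart f hf
    obtain ⟨h, hh, heq⟩ := hμ.exists_eqOn_disc hchart
    refine (hC₁ h _ M hh heq fun z hz => hbound (hchart.mapsTo hz)).trans ?_
    gcongr
    exact (le_max_left _ _).trans (le_max_right _ _)
  · have hchart := A.isCuspChart c hc
    obtain ⟨h, hh, heq⟩ := hμ.exists_eqOn_cusp hchart
    refine (hC₂ h _ M hh heq fun z hz => hbound (hchart.mapsTo hz)).trans ?_
    gcongr
    exact (le_max_right _ _).trans (le_max_right _ _)

end Comparison

end HarmonicBeltrami

end

theorem mainTheorem5_general (k : ℕ) {α : ℝ} (hα : α ≤ 1) :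
    ∃ C : ℝ≥0, 0 < C ∧
      ∀ (X : Type u) [TopologicalSpace X] [ChartedSpace ℂ X] [IsManifold 𝓘(ℂ, ℂ) ω X]
        (P : Set X) (Λ : HarmonicBeltrami.Differential X 1 1)
        (A : HarmonicBeltrami.UniformizingAtlas P Λ)
        (μ : HarmonicBeltrami.Differential X (-1) 1), HarmonicBeltrami.IsHarmonic P Λ μ →
        (CompactSpace X → HarmonicBeltrami.supNorm P μ < ⊤) ∧
          HarmonicBeltrami.supNorm P μ ≤ HarmonicBeltrami.holderNorm A k α μ ∧
          HarmonicBeltrami.holderNorm A k α μ ≤ C * HarmonicBeltrami.supNorm P μ := by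
  obtain ⟨C, hC, hle⟩ := HarmonicBeltrami.exists_holderNorm_le_mul_supNorm k hα
  exact ⟨C, hC, fun X _ _ _ P Λ A μ hμ => ⟨fun _ => hμ.supNorm_lt_top A,
    HarmonicBeltrami.supNorm_le_holderNorm A k α μ, hle X P Λ A μ hμ⟩⟩

theorem mainTheorem5 (k : ℕ) (α : ℝ) (hα₀ : 0 < α) (hα₁ : α < 1) :
    ∃ C : ℝ≥0, 0 < C ∧
      ∀ (X : Type u) [TopologicalSpace X] [T2Space X] [CompactSpace X] [ConnectedSpace X]
        [ChartedSpace ℂ X] [IsManifold 𝓘(ℂ, ℂ) ω X]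
        (P : Set X) (_ : P.Finite)
        (Λ : HarmonicBeltrami.Differential X 1 1)
        (_ : HarmonicBeltrami.IsHyperbolicMetric P Λ)
        (A : HarmonicBeltrami.UniformizingAtlas P Λ)
        (μ : HarmonicBeltrami.Differential X (-1) 1)
        (_ : HarmonicBeltrami.IsHarmonic P Λ μ),
        HarmonicBeltrami.supNorm P μ < ⊤ ∧
          HarmonicBeltrami.supNorm P μ ≤ HarmonicBeltrami.holderNorm A k α μ ∧
          HarmonicBeltrami.holderNorm A k α μ ≤ C * HarmonicBeltrami.supNorm P μ := by
  obtain ⟨C, hC, h⟩ := mainTheorem5_general k hα₁.le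
  exact ⟨C, hC, fun X _ _ _ _ _ _ P _ Λ _ A μ hμ => (h X P Λ A μ hμ).imp_left (· inferInstance)⟩
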